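/- **Conventions.** Work in the two-sorted language of second-order arithmetic (number variables; set variables; $0,1,+,\cdot,<,\in$). The theory $\mathsf{RCA}_0$ consists of the axioms of a discretely ordered commutative semiring with identity, induction for $\Sigma^0_1$ formulas, and $\Delta^0_1$ comprehension; $\mathsf{ACA}_0$ consists of the same semiring axioms, the induction axiom $\forall X[(0\in X\wedge\forall n(n\in X\to n+1\in X))\to\forall n\,(n\in X)]$, and comprehension for all arithmetical formulas. Parameters are allowed in all schemes. The following definitions are made in $\mathsf{RCA}_0$. Pairs and finite sets of numbers are coded by numbers in the usual way. A quasi-order $(Q,\le_Q)$ is a set $Q\subseteq\mathbb N$ with a reflexive and transitive relation $\le_Q\,\subseteq Q\times Q$. It is a *wqo* if for every function $f:\mathbb N\to Q$ there are $m<n$ with $f(m)\le_Q f(n)$. Let $\mathcal P_{\mathrm f}(Q)$ be the set of (codes of) finite subsets of $Q$, and let $\mathcal P_{\mathrm f}^\flat(Q)$ be $\mathcal P_{\mathrm f}(Q)$ with the quasi-order $$\mathbf a\le^\flat_Q\mathbf b \iff (\forall a\in\mathbf a)(\exists b\in\mathbf b)(a\le_Q b).$$ For a quasi-order $R$, let $\mathrm{upper}(R)$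 be the countable second-countable space with set of points $R$ and basic open sets $$U_{\mathbf i}=\{x\in R:\neg(\exists p\in\mathbf i)(x\le_R p)\},\qquad \mathbf i\in\mathcal P_{\mathrm f}(R).$$ A function $g:\mathbb N\times\mathbb N\to\mathcal P_{\mathrm f}(\mathcal P_{\mathrm f}(R))$ codes the sequence of effectively closed sets $F_n=\{x\in R:\forall m\,(\forall \mathbf i\in g(n,m))\,(x\notin U_{\mathbf i})\}$. The space $\mathrm{upper}(R)$ is *Noetherian* if for every such sequence with $F_{n+1}\subseteq F_n$ for all $n$, there is an $N$ such that $F_n=F_N$ for all $n>N$. **Theorem.** Over $\mathsf{RCA}_0$, the statement "if $Q$ is a wqo, then $\mathrm{upper}(\mathcal P_{\mathrm f}^\flat(Q))$ is Noetherian" (for all quasi-orders $Q$) implies $\mathsf{ACA}_0$. That is, every structure for the language of second-order arithmetic (with arbitrary, possibly nonstandard, first-order part and with set variables ranging over an arbitrary nonempty family of subsets of it) that satisfies $\mathsf{RCA}_0$ and this statement also satisfies $\mathsf{ACA}_0$. -/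

import Mathlib

namespace SecondOrderArithmetic

universe u

/-! ### The language of second-order arithmetic and its structures -/

/-- Numerical terms. Number variables are de Bruijn indices. -/
inductive Term where
  | var (i : ℕ) : Term
  | zero : Term
  | one : Term
  | add (t s : Term) : Term
  | mul (t s : Term) : Term

/-- Raise all variables of a term by one, so that it does not mention the variable `0`. -/
def Term.shift : Term → Term
  | var i => var (i + 1)
  | zero => zero
  | one => one
  | add t s => add t.shift s.shift
  | mul t s => mul t.shift s.shift

/-- Formulas of the two-sorted language of second-order arithmetic. Number variables and set
variables are two separate families of de Bruijn indices; `all` binds the number variable `0`,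
`allSet` binds the set variable `0`. -/
inductive Formula where
  | eq (t s : Term) : Formula
  | lt (t s : Term) : Formula
  | mem (t : Term) (X : ℕ) : Formula
  | neg (φ : Formula) : Formula
  | imp (φ ψ : Formula) : Formula
  | all (φ : Formula) : Formula
  | allSet (φ : Formula) : Formula

/-- The number quantifier `∃`. -/
def Formula.ex (φ : Formula) : Formula := .neg (.all (.neg φ))

/-- `∀ x < t, φ`, where `x` is bound and does not occur in `t`. -/
def Formula.ballLT (t : Term) (φ : Formula) : Formula :=
  .all (.imp (.lt (.var 0) t.shift) φ)

/-- `Σ⁰₀` formulas: all quantifiers are bounded number quantifiers. Bounded existential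
quantifiers are obtained from bounded universal ones by negation. -/
inductive Formula.IsSigma00 : Formula → Prop
  | eq (t s : Term) : IsSigma00 (.eq t s)
  | lt (t s : Term) : IsSigma00 (.lt t s)
  | mem (t : Term) (X : ℕ) : IsSigma00 (.mem t X)
  | neg {φ : Formula} : IsSigma00 φ → IsSigma00 (.neg φ)
  | imp {φ ψ : Formula} : IsSigma00 φ → IsSigma00 ψ → IsSigma00 (.imp φ ψ)
  | ballLT (t : Term) {φ : Formula} : IsSigma00 φ → IsSigma00 (Formula.ballLT t φ)

/-- `Σ⁰₁` formulas: `∃ x, θ` with `θ` a `Σ⁰₀` formula. -/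
def Formula.IsSigma01 (φ : Formula) : Prop := ∃ θ : Formula, θ.IsSigma00 ∧ φ = .ex θ

/-- `Π⁰₁` formulas: `∀ x, θ` with `θ` a `Σ⁰₀` formula. -/
def Formula.IsPi01 (φ : Formula) : Prop := ∃ θ : Formula, θ.IsSigma00 ∧ φ = .all θ

/-- Arithmetical formulas: no set quantifiers (free set variables are allowed). -/
def Formula.IsArithmetical : Formula → Prop
  | .eq _ _ => True
  | .lt _ _ => True
  | .mem _ _ => True
  | .neg φ => φ.IsArithmetical
  | .imp φ ψ => φ.IsArithmetical ∧ ψ.IsArithmetical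
  | .all φ => φ.IsArithmetical
  | .allSet _ => False

/-- A structure for the language of second-order arithmetic: number variables range over `M`,
which may be nonstandard, and set variables range over the nonempty family `sets` of subsets
of `M`, which need not contain all subsets. -/
class L2Structure (M : Type u) extends Zero M, One M, Add M, Mul M, LT M where
  sets : Set (Set M)
  sets_nonempty : sets.Nonempty

/-- Extend an assignment by a value for the variable `0`. -/
def push {α : Type u} (a : α) (e : ℕ → α) : ℕ → α
  | 0 => a
  | k + 1 => e k

section Semantics

variable {M : Type u} [L2Structure M]

/-- The value of a term. -/
def Term.val (e : ℕ → M) : Term → M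
  | var i => e i
  | zero => 0
  | one => 1
  | add t s => t.val e + s.val e
  | mul t s => t.val e * s.val e

/-- Satisfaction of a formula under an assignment of numbers and sets to the variables. -/
def Formula.Holds : Formula → (ℕ → M) → (ℕ → Set M) → Prop
  | .eq t s, e, _ => t.val e = s.val e
  | .lt t s, e, _ => t.val e < s.val e
  | .mem t X, e, E => t.val e ∈ E X
  | .neg φ, e, E => ¬ φ.Holds e E
  | .imp φ ψ, e, E => φ.Holds e E → ψ.Holds e E
  | .all φ, e, E => ∀ x : M, φ.Holds (push x e) E
  | .allSet φ, e, E => ∀ X ∈ L2Structure.sets (M := M), φ.Holds e (push X E)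

end Semantics

/-! ### The theories `RCA₀` and `ACA₀` -/

/-- The numbers form a discretely ordered commutative semiring with identity. -/
structure DiscretelyOrderedSemiring (M : Type u) [L2Structure M] : Prop where
  add_assoc : ∀ x y z : M, (x + y) + z = x + (y + z)
  add_comm : ∀ x y : M, x + y = y + x
  add_zero : ∀ x : M, x + 0 = x
  mul_assoc : ∀ x y z : M, (x * y) * z = x * (y * z)
  mul_comm : ∀ x y : M, x * y = y * x
  mul_one : ∀ x : M, x * 1 = x
  mul_zero : ∀ x : M, x * 0 = 0
  mul_add : ∀ x y z : M, x * (y + z) = x * y + x * z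
  lt_irrefl : ∀ x : M, ¬ x < x
  lt_trans : ∀ x y z : M, x < y → y < z → x < z
  lt_trichotomy : ∀ x y : M, x < y ∨ x = y ∨ y < x
  add_lt_add : ∀ x y z : M, x < y → x + z < y + z
  mul_lt_mul : ∀ x y z : M, 0 < z → x < y → x * z < y * z
  exists_add_of_lt : ∀ x y : M, x < y → ∃ z : M, x + z = y
  zero_lt_one : (0 : M) < 1
  eq_or_lt : ∀ x : M, x = 0 ∨ 0 < x
  discrete : ∀ x : M, 0 < x → x = 1 ∨ 1 < x

/-- `M` is a model of `RCA₀`. The parameters of the schemes are the values of `e` and `E`; the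
variable that an instance singles out is the number variable `0`. -/
structure IsModelRCA0 (M : Type u) [L2Structure M] : Prop where
  semiring : DiscretelyOrderedSemiring M
  sigma01_induction : ∀ φ : Formula, φ.IsSigma01 →
    ∀ (e : ℕ → M) (E : ℕ → Set M), (∀ k, E k ∈ L2Structure.sets) →
      φ.Holds (push 0 e) E →
      (∀ n : M, φ.Holds (push n e) E → φ.Holds (push (n + 1) e) E) →
      ∀ n : M, φ.Holds (push n e) E
  delta01_comprehension : ∀ φ ψ : Formula, φ.IsSigma01 → ψ.IsPi01 →
    ∀ (e : ℕ → M) (E : ℕ → Set M), (∀ k, E k ∈ L2Structure.sets) →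
      (∀ n : M, φ.Holds (push n e) E ↔ ψ.Holds (push n e) E) →
      ∃ X ∈ L2Structure.sets (M := M), ∀ n : M, n ∈ X ↔ φ.Holds (push n e) E

/-- `M` is a model of `ACA₀`. -/
structure IsModelACA0 (M : Type u) [L2Structure M] : Prop where
  semiring : DiscretelyOrderedSemiring M
  induction : ∀ X ∈ L2Structure.sets (M := M),
    (0 : M) ∈ X → (∀ n : M, n ∈ X → n + 1 ∈ X) → ∀ n : M, n ∈ X
  arithmetical_comprehension : ∀ φ : Formula, φ.IsArithmetical →
    ∀ (e : ℕ → M) (E : ℕ → Set M), (∀ k, E k ∈ L2Structure.sets) →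
      ∃ X ∈ L2Structure.sets (M := M), ∀ n : M, n ∈ X ↔ φ.Holds (push n e) E

/-! ### Coding inside a structure -/

section Coding

variable {M : Type u} [L2Structure M]

/-- The code `(i + j)² + i` of an ordered pair. -/
def pair (i j : M) : M := (i + j) * (i + j) + i

/-- `c` is of the form `(k, (m, n))`; such a triple represents the finite set of all `i < k` for
which `m (i + 1) + 1` divides `n`. -/
def IsTriple (c : M) : Prop := ∃ k m n : M, c = pair k (pair m n)

/-- `i` belongs to the finite set represented by `c`. -/
def FinMem (i c : M) : Prop :=
  ∃ k m n : M, c = pair k (pair m n) ∧ i < k ∧ ∃ q : M, n = (m * (i + 1) + 1) * q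

/-- `c` is the code of a finite set, that is, the least number representing it. -/
def IsFinCode (c : M) : Prop :=
  IsTriple c ∧ ∀ d : M, d < c → IsTriple d → ¬ ∀ i : M, FinMem i d ↔ FinMem i c

/-- `P_f(A)`: the (codes of) finite subsets of `A`. -/
def finSubsets (A : Set M) : Set M := {c | IsFinCode c ∧ ∀ i : M, FinMem i c → i ∈ A}

/-- The product `A × B`, as a set of codes of pairs. -/
def prodSet (A B : Set M) : Set M := {p | ∃ a ∈ A, ∃ b ∈ B, p = pair a b}

/-- `F` is a member of the second-order part that is (the graph of) a function `A → B`. -/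
def IsFunction (F A B : Set M) : Prop :=
  F ∈ L2Structure.sets ∧ F ⊆ prodSet A B ∧ ∀ a ∈ A, ∃! b : M, pair a b ∈ F

end Coding

/-! ### Quasi-orders -/

/-- A set of numbers together with a binary relation given as a set of codes of pairs. -/
structure CodedRel (M : Type u) where
  carrier : Set M
  le : Set M

section Orders

variable {M : Type u} [L2Structure M]

/-- `a ≤_Q b`. -/
def CodedRel.Le (Q : CodedRel M) (a b : M) : Prop := pair a b ∈ Q.le

/-- `Q` is a quasi-order of the structure: its domain and its relation belong to the
second-order part, and the relation is reflexive and transitive on the domain. -/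
structure CodedRel.IsQuasiOrder (Q : CodedRel M) : Prop where
  carrier_mem : Q.carrier ∈ L2Structure.sets
  le_mem : Q.le ∈ L2Structure.sets
  le_subset : Q.le ⊆ prodSet Q.carrier Q.carrier
  refl : ∀ q ∈ Q.carrier, Q.Le q q
  trans : ∀ p ∈ Q.carrier, ∀ q ∈ Q.carrier, ∀ r ∈ Q.carrier, Q.Le p q → Q.Le q r → Q.Le p r

/-- `Q` is a well-quasi-order: for every function `f : ℕ → Q` of the structure there are `m < n`
with `f m ≤_Q f n`. -/
def CodedRel.IsWqo (Q : CodedRel M) : Prop :=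
  Q.IsQuasiOrder ∧ ∀ F : Set M, IsFunction F Set.univ Q.carrier →
    ∃ m n a b : M, m < n ∧ pair m a ∈ F ∧ pair n b ∈ F ∧ Q.Le a b

/-- `P_f^♭(Q)`: the finite subsets of `Q`, with `a ≤^♭ b` if and only if every element of `a` is
below some element of `b`. -/
def CodedRel.finFlat (Q : CodedRel M) : CodedRel M where
  carrier := finSubsets Q.carrier
  le := {p | ∃ a ∈ finSubsets Q.carrier, ∃ b ∈ finSubsets Q.carrier, p = pair a b ∧
    ∀ i : M, FinMem i a → ∃ j : M, FinMem j b ∧ Q.Le i j}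

end Orders

/-! ### Countable second-countable spaces -/

/-- A set `points` of numbers with a family `(U_i)` of subsets indexed by `index`, where
`basic x i` says that `x ∈ U_i`. A base also has a function `k` with
`x ∈ U_{k(x,i,j)} ⊆ U_i ∩ U_j` for `x ∈ U_i ∩ U_j`; effectively open and closed sets, and being
Noetherian, do not refer to it. -/
structure CodedSpace (M : Type u) where
  points : Set M
  index : Set M
  basic : M → M → Prop

section Spaces

variable {M : Type u} [L2Structure M]

/-- The `n`-th term of the sequence of effectively closed sets coded by a function
`G : ℕ × ℕ → P_f(I)`: the points that lie in no `U_i` with `i ∈ G(n, m)`, for any `m`. -/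
def CodedSpace.closedTerm (X : CodedSpace M) (G : Set M) (n : M) : Set M :=
  {x ∈ X.points | ∀ m c i : M, pair (pair n m) c ∈ G → FinMem i c → ¬ X.basic x i}

/-- Every descending sequence of effectively closed sets (coded in the structure) stabilizes. -/
def CodedSpace.IsNoetherian (X : CodedSpace M) : Prop :=
  ∀ G : Set M, IsFunction G (prodSet Set.univ Set.univ) (finSubsets X.index) →
    (∀ n : M, X.closedTerm G (n + 1) ⊆ X.closedTerm G n) →
    ∃ N : M, ∀ n : M, N < n → X.closedTerm G n = X.closedTerm G N

/-- The upper topology of `Q`: its basic open sets are the sets `Q \ (i↓)` for `i ∈ P_f(Q)`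
(so that the function `k` of the base is `k(q, i, j) = i ∪ j`). -/
def CodedRel.upper (Q : CodedRel M) : CodedSpace M where
  points := Q.carrier
  index := finSubsets Q.carrier
  basic x i := x ∈ Q.carrier ∧ ¬ ∃ p : M, FinMem p i ∧ Q.Le x p

end Spaces

/-- `M` satisfies the statement "if `Q` is a well-quasi-order, then the upper topology of
`P_f^♭(Q)` is Noetherian". -/
def FlatUpperNoetherian (M : Type u) [L2Structure M] : Prop :=
  ∀ Q : CodedRel M, Q.IsWqo → Q.finFlat.upper.IsNoetherian

end SecondOrderArithmetic

namespace SecondOrderArithmetic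

universe u

/-! ### Models of `RCA₀` as ordered semirings -/

/-! By `isModelACA0_of_sigma1Comprehension` it is enough to form an arbitrary `Σ⁰₁` set. By
`exists_pairedEnumeration` such a set is computable from the range of a definable injection `g` with
`g 0 = 0` and `g (2r + 1) = g (2r) + 1`. If the range of `g` is missing from the model, a wqo is
built whose flat finite powerset is not Noetherian.

Call a stage `x` true if no later stage has a smaller value of `g`, and false otherwise. Any
unbounded set of true stages decides the range: at a true `x` with `n < g x`, the number `n` is
enumerated by stage `x` or never. Order the stages so that `x` precedes a later `y` exactly if `x`
has been seen to be false by stage `y`; seen from outside, the true stages then form a descending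
sequence above all false ones. Order the values by `g`, except that `0` and `1` are made the two
largest elements, with `0` below `1`. The order `stageValueOrder g` is the product of the two. In a
bad sequence the stages are unbounded (`bad_unbounded`), and from some point on all large ones are
true (`bad_eventually_true`). A bad sequence in the model therefore puts the range of `g` into the
model, and otherwise the product is a wqo (`stageValueOrder_isWqo`).

The finite subsets nevertheless have a bad sequence: the `n`-th set `a_n` consists of the pairs
`(2s, 2r + 1)` with `NextStage g n s r`. Doubling supplies predecessors: `2s + 1` comes just before
`2s` among the stages, and `2r` just before `2r + 1` among the values. Stage `0` and value `1` are
greatest, so avoiding the cone above `(2s, 2r + 1)` amounts to lying below `(2s + 1, 1)` or `(0,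
2r)`. Closed sets of the upper topology can thus express that `a_m` is not `≤♭ x` for all `m ≤ n`.
The set `a_{N+1}` lies in the `N`-th closed set by `exists_nextStage_bound` but not in the next one,
which gives `not_isNoetherian`. -/

/-- Type-class form of `IsModelRCA0`. -/
class ModelRCA0 (M : Type u) [L2Structure M] : Prop where
  out : IsModelRCA0 M

section Arithmetic

variable {M : Type u} [L2Structure M] [ModelRCA0 M]

instance instCommSemiring : CommSemiring M where
  add_assoc := ModelRCA0.out.semiring.add_assoc
  add_comm := ModelRCA0.out.semiring.add_comm
  add_zero := ModelRCA0.out.semiring.add_zero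
  zero_add x := (ModelRCA0.out.semiring.add_comm _ _).trans (ModelRCA0.out.semiring.add_zero x)
  mul_assoc := ModelRCA0.out.semiring.mul_assoc
  mul_comm := ModelRCA0.out.semiring.mul_comm
  mul_one := ModelRCA0.out.semiring.mul_one
  one_mul x := (ModelRCA0.out.semiring.mul_comm _ _).trans (ModelRCA0.out.semiring.mul_one x)
  mul_zero := ModelRCA0.out.semiring.mul_zero
  zero_mul x := (ModelRCA0.out.semiring.mul_comm _ _).trans (ModelRCA0.out.semiring.mul_zero x)
  left_distrib := ModelRCA0.out.semiring.mul_add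
  right_distrib x y z := by
    rw [ModelRCA0.out.semiring.mul_comm, ModelRCA0.out.semiring.mul_add,
      ModelRCA0.out.semiring.mul_comm z x, ModelRCA0.out.semiring.mul_comm z y]
  nsmul := nsmulRec
  npow := npowRec

open Classical in
noncomputable instance instLinearOrder : LinearOrder M where
  le x y := x < y ∨ x = y
  le_refl _ := Or.inr rfl
  le_trans x y z := by
    rintro (h | rfl) (h' | rfl)
    exacts [Or.inl (ModelRCA0.out.semiring.lt_trans _ _ _ h h'), Or.inl h, Or.inl h', Or.inr rfl]
  lt_iff_le_not_ge x y := by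
    constructor
    · refine fun h => ⟨Or.inl h, ?_⟩
      rintro (h' | rfl)
      · exact ModelRCA0.out.semiring.lt_irrefl _ (ModelRCA0.out.semiring.lt_trans _ _ _ h h')
      · exact ModelRCA0.out.semiring.lt_irrefl _ h
    · rintro ⟨h | rfl, h'⟩
      · exact h
      · exact absurd (Or.inr rfl) h'
  le_antisymm x y := by
    rintro (h | rfl) (h' | h')
    · exact absurd (ModelRCA0.out.semiring.lt_trans _ _ _ h h') (ModelRCA0.out.semiring.lt_irrefl _)
    all_goals first | exact h'.symm | rfl
  le_total x y := by
    rcases ModelRCA0.out.semiring.lt_trichotomy x y with h | h | h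
    exacts [Or.inl (Or.inl h), Or.inl (Or.inr h), Or.inr (Or.inl h)]
  toDecidableLE := Classical.decRel _

instance instIsStrictOrderedRing : IsStrictOrderedRing M :=
  have h₁ : ∀ a b c : M, a < b → c + a < c + b := fun a b c h => by
    rw [add_comm c a, add_comm c b]
    exact ModelRCA0.out.semiring.add_lt_add _ _ _ h
  { add_le_add_left := fun a b h c => by
      rcases h with h | rfl
      · exact (ModelRCA0.out.semiring.add_lt_add _ _ _ h).le
      · exact le_rfl
    le_of_add_le_add_left := fun a b c h => by
      by_contra! hb
      exact absurd h (not_le.2 (h₁ _ _ _ hb))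
    zero_le_one := (ModelRCA0.out.semiring.zero_lt_one).le
    exists_pair_ne := ⟨0, 1, (ModelRCA0.out.semiring.zero_lt_one : (0 : M) < 1).ne⟩
    mul_lt_mul_of_pos_left := fun c hc a b h => by
      change c * a < c * b
      rw [mul_comm c a, mul_comm c b]
      exact ModelRCA0.out.semiring.mul_lt_mul _ _ _ hc h
    mul_lt_mul_of_pos_right := fun c hc a b h =>
      ModelRCA0.out.semiring.mul_lt_mul _ _ _ hc h }

instance instCanonicallyOrderedAdd : CanonicallyOrderedAdd M where
  exists_add_of_le {a b} h := by
    rcases h with h | rfl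
    · obtain ⟨c, hc⟩ := ModelRCA0.out.semiring.exists_add_of_lt _ _ h
      exact ⟨c, hc.symm⟩
    · exact ⟨0, (add_zero _).symm⟩
  le_add_self a b := by
    rcases ModelRCA0.out.semiring.eq_or_lt b with h | h
    · rw [h, zero_add]
    · exact (by simpa using (add_lt_add_of_lt_of_le h (le_refl a)) : a < b + a).le
  le_self_add a b := by
    rcases ModelRCA0.out.semiring.eq_or_lt b with h | h
    · rw [h, add_zero]
    · exact (by simpa using (add_lt_add_of_le_of_lt (le_refl a) h) : a < a + b).le

theorem one_le_of_pos {x : M} (h : 0 < x) : 1 ≤ x := by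
  rcases ModelRCA0.out.semiring.discrete x h with h | h
  exacts [h.ge, h.le]

theorem lt_add_one_iff {x y : M} : x < y + 1 ↔ x ≤ y := by
  constructor
  · intro h
    by_contra! hy
    obtain ⟨z, rfl⟩ := exists_add_of_le hy.le
    have hz : 0 < z := by
      rw [pos_iff_ne_zero]
      rintro rfl
      simp at hy
    exact absurd h (not_lt.2 (add_le_add le_rfl (one_le_of_pos hz)))
  · intro h
    exact lt_of_le_of_lt h (lt_add_of_pos_right _ zero_lt_one)

theorem add_one_le_iff {x y : M} : x + 1 ≤ y ↔ x < y := by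
  rw [← not_lt, lt_add_one_iff, not_le]

theorem eq_zero_or_succ (x : M) : x = 0 ∨ ∃ y, x = y + 1 := by
  rcases eq_or_ne x 0 with h | h
  · exact Or.inl h
  · obtain ⟨z, hz⟩ := exists_add_of_le (one_le_of_pos (pos_iff_ne_zero.2 h))
    exact Or.inr ⟨z, by rw [hz, add_comm]⟩

/-! ### Pairing -/

theorem le_sq (x : M) : x ≤ x * x := by
  rcases eq_or_ne x 0 with h | h
  · simp [h]
  · exact le_mul_of_one_le_left' (one_le_of_pos (pos_iff_ne_zero.2 h))

theorem left_le_pair (i j : M) : i ≤ pair i j := le_add_self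

theorem right_le_pair (i j : M) : j ≤ pair i j :=
  (le_add_self.trans (le_sq (i + j))).trans le_self_add

theorem pair_mono {i j i' j' : M} (hi : i ≤ i') (hj : j ≤ j') : pair i j ≤ pair i' j' :=
  add_le_add (mul_le_mul' (add_le_add hi hj) (add_le_add hi hj)) hi

/-- The code lies between `(i + j)²` and `(i + j + 1)²`, the latter excluded, so it determines the
sum. -/
theorem pair_lt_of_sum_lt {i j i' j' : M} (h : i + j < i' + j') : pair i j < pair i' j' := by
  have h1 : i + j + 1 ≤ i' + j' := add_one_le_iff.2 h
  have h2 : (i + j + 1) * (i + j + 1) ≤ (i' + j') * (i' + j') := mul_le_mul' h1 h1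
  have h3 : pair i j < (i + j + 1) * (i + j + 1) := by
    have : (i + j + 1) * (i + j + 1) = pair i j + (i + j + j + 1) := by unfold pair; ring
    rw [this]
    exact lt_add_of_pos_right _ (lt_of_lt_of_le zero_lt_one le_add_self)
  exact h3.trans_le (h2.trans le_self_add)

theorem pair_inj {i j i' j' : M} : pair i j = pair i' j' ↔ i = i' ∧ j = j' := by
  constructor
  · intro h
    have hs : i + j = i' + j' := by
      rcases lt_trichotomy (i + j) (i' + j') with h' | h' | h'
      · exact absurd h (pair_lt_of_sum_lt h').ne
      · exact h'
      · exact absurd h (pair_lt_of_sum_lt h').ne'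
    have hi : i = i' := by
      unfold pair at h
      rw [hs] at h
      exact add_left_cancel h
    subst hi
    exact ⟨rfl, add_left_cancel hs⟩
  · rintro ⟨rfl, rfl⟩
    rfl

end Arithmetic

/-! ### Renaming of variables -/

/-- Extend a renaming under a binder. -/
def liftRename (ρ : ℕ → ℕ) : ℕ → ℕ
  | 0 => 0
  | k + 1 => ρ k + 1

def Term.rename (ρ : ℕ → ℕ) : Term → Term
  | var i => var (ρ i)
  | zero => zero
  | one => one
  | add t s => add (t.rename ρ) (s.rename ρ)
  | mul t s => mul (t.rename ρ) (s.rename ρ)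

def Formula.rename : Formula → (ℕ → ℕ) → (ℕ → ℕ) → Formula
  | .eq t s, ρ, _ => .eq (t.rename ρ) (s.rename ρ)
  | .lt t s, ρ, _ => .lt (t.rename ρ) (s.rename ρ)
  | .mem t X, ρ, σ => .mem (t.rename ρ) (σ X)
  | .neg φ, ρ, σ => .neg (φ.rename ρ σ)
  | .imp φ ψ, ρ, σ => .imp (φ.rename ρ σ) (ψ.rename ρ σ)
  | .all φ, ρ, σ => .all (φ.rename (liftRename ρ) σ)
  | .allSet φ, ρ, σ => .allSet (φ.rename ρ (liftRename σ))

theorem push_comp_liftRename {α : Type*} (x : α) (e : ℕ → α) (ρ : ℕ → ℕ) :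
    push x e ∘ liftRename ρ = push x (e ∘ ρ) := by
  funext k
  cases k <;> rfl

theorem Term.shift_rename (t : Term) (ρ : ℕ → ℕ) :
    t.shift.rename (liftRename ρ) = (t.rename ρ).shift := by
  induction t with
  | var i => rfl
  | zero => rfl
  | one => rfl
  | add t s iht ihs => simp [Term.shift, Term.rename, iht, ihs]
  | mul t s iht ihs => simp [Term.shift, Term.rename, iht, ihs]

theorem Formula.IsSigma00.rename {φ : Formula} (h : φ.IsSigma00) (ρ σ : ℕ → ℕ) :
    (φ.rename ρ σ).IsSigma00 := by
  induction h generalizing ρ with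
  | eq t s => exact .eq _ _
  | lt t s => exact .lt _ _
  | mem t X => exact .mem _ _
  | neg _ ih => exact .neg (ih ρ)
  | imp _ _ ih₁ ih₂ => exact .imp (ih₁ ρ) (ih₂ ρ)
  | ballLT t _ ih =>
    have := IsSigma00.ballLT (t.rename ρ) (ih (liftRename ρ))
    rw [Formula.ballLT, ← Term.shift_rename] at this
    exact this

/-! ### Evaluation under renaming, and dependence on finitely many variables -/

section

variable {M : Type u} [L2Structure M]

theorem Term.val_rename (t : Term) (ρ : ℕ → ℕ) (e : ℕ → M) :
    (t.rename ρ).val e = t.val (e ∘ ρ) := by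
  induction t with
  | var i => rfl
  | zero => rfl
  | one => rfl
  | add t s iht ihs => simp [Term.val, Term.rename, iht, ihs]
  | mul t s iht ihs => simp [Term.val, Term.rename, iht, ihs]

theorem Term.val_shift (t : Term) (x : M) (e : ℕ → M) : t.shift.val (push x e) = t.val e := by
  induction t with
  | var i => rfl
  | zero => rfl
  | one => rfl
  | add t s iht ihs => simp [Term.val, Term.shift, iht, ihs]
  | mul t s iht ihs => simp [Term.val, Term.shift, iht, ihs]

theorem Formula.holds_rename (φ : Formula) (ρ σ : ℕ → ℕ) (e : ℕ → M) (E : ℕ → Set M) :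
    (φ.rename ρ σ).Holds e E ↔ φ.Holds (e ∘ ρ) (E ∘ σ) := by
  induction φ generalizing ρ σ e E with
  | eq t s => simp [Formula.rename, Formula.Holds, Term.val_rename]
  | lt t s => simp [Formula.rename, Formula.Holds, Term.val_rename]
  | mem t X => simp [Formula.rename, Formula.Holds, Term.val_rename]
  | neg φ ih => simp [Formula.rename, Formula.Holds, ih]
  | imp φ ψ ih₁ ih₂ => simp [Formula.rename, Formula.Holds, ih₁, ih₂]
  | all φ ih => simp [Formula.rename, Formula.Holds, ih, push_comp_liftRename]
  | allSet φ ih => simp [Formula.rename, Formula.Holds, ih, push_comp_liftRename]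

theorem Term.val_support (t : Term) :
    ∃ N : ℕ, ∀ e e' : ℕ → M, (∀ k < N, e k = e' k) → t.val e = t.val e' := by
  induction t with
  | var i => exact ⟨i + 1, fun e e' h => h i (Nat.lt_succ_self i)⟩
  | zero => exact ⟨0, fun _ _ _ => rfl⟩
  | one => exact ⟨0, fun _ _ _ => rfl⟩
  | add t s iht ihs =>
    obtain ⟨N₁, h₁⟩ := iht
    obtain ⟨N₂, h₂⟩ := ihs
    refine ⟨max N₁ N₂, fun e e' h => ?_⟩
    simp only [Term.val, h₁ e e' fun k hk => h k (lt_max_of_lt_left hk),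
      h₂ e e' fun k hk => h k (lt_max_of_lt_right hk)]
  | mul t s iht ihs =>
    obtain ⟨N₁, h₁⟩ := iht
    obtain ⟨N₂, h₂⟩ := ihs
    refine ⟨max N₁ N₂, fun e e' h => ?_⟩
    simp only [Term.val, h₁ e e' fun k hk => h k (lt_max_of_lt_left hk),
      h₂ e e' fun k hk => h k (lt_max_of_lt_right hk)]

theorem Formula.holds_support (φ : Formula) :
    ∃ N : ℕ, ∀ (e e' : ℕ → M) (E : ℕ → Set M), (∀ k < N, e k = e' k) →
      (φ.Holds e E ↔ φ.Holds e' E) := by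
  induction φ with
  | eq t s =>
    obtain ⟨N₁, h₁⟩ := t.val_support (M := M)
    obtain ⟨N₂, h₂⟩ := s.val_support (M := M)
    refine ⟨max N₁ N₂, fun e e' E h => ?_⟩
    simp only [Formula.Holds, h₁ e e' fun k hk => h k (lt_max_of_lt_left hk),
      h₂ e e' fun k hk => h k (lt_max_of_lt_right hk)]
  | lt t s =>
    obtain ⟨N₁, h₁⟩ := t.val_support (M := M)
    obtain ⟨N₂, h₂⟩ := s.val_support (M := M)
    refine ⟨max N₁ N₂, fun e e' E h => ?_⟩
    simp only [Formula.Holds, h₁ e e' fun k hk => h k (lt_max_of_lt_left hk),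
      h₂ e e' fun k hk => h k (lt_max_of_lt_right hk)]
  | mem t X =>
    obtain ⟨N₁, h₁⟩ := t.val_support (M := M)
    exact ⟨N₁, fun e e' E h => by simp only [Formula.Holds, h₁ e e' h]⟩
  | neg φ ih =>
    obtain ⟨N, h⟩ := ih
    exact ⟨N, fun e e' E he => not_congr (h e e' E he)⟩
  | imp φ ψ ih₁ ih₂ =>
    obtain ⟨N₁, h₁⟩ := ih₁
    obtain ⟨N₂, h₂⟩ := ih₂
    exact ⟨max N₁ N₂, fun e e' E h => imp_congr (h₁ e e' E fun k hk => h k (lt_max_of_lt_left hk))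
      (h₂ e e' E fun k hk => h k (lt_max_of_lt_right hk))⟩
  | all φ ih =>
    obtain ⟨N, h⟩ := ih
    refine ⟨N, fun e e' E he => forall_congr' fun x => h _ _ E fun k hk => ?_⟩
    cases k with
    | zero => rfl
    | succ k => exact he k (Nat.lt_of_succ_lt hk)
  | allSet φ ih =>
    obtain ⟨N, h⟩ := ih
    exact ⟨N, fun e e' E he => forall₂_congr fun X _ => h _ _ _ he⟩

end

/-! ### Predicates definable by `Σ⁰₀` formulas with parameters -/

/-- Interleave two sequences. -/
def interleave {α : Type*} (e p : ℕ → α) (k : ℕ) : α := if k % 2 = 0 then e (k / 2) else p (k / 2)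

section

variable {α : Type*}

/-- Even positions hold variables and stay fixed. Odd positions hold parameters: in a merged
sequence those of the first predicate sit at `4j + 1`, those of the second at `4j + 3`. -/
def leftRename (k : ℕ) : ℕ := if k % 2 = 0 then k else 4 * (k / 2) + 1

def rightRename (k : ℕ) : ℕ := if k % 2 = 0 then k else 4 * (k / 2) + 3

/-- A new bound variable at the front exchanges the parities of the old variables and the
parameters; this renaming restores the interleaved layout. -/
def binderRename (k : ℕ) : ℕ := if k = 0 then 0 else if k % 2 = 0 then k - 1 else k + 1

theorem interleave_comp_left (e p q : ℕ → α) :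
    interleave e (interleave p q) ∘ leftRename = interleave e p := by
  funext k
  by_cases hk : k % 2 = 0
  · simp [interleave, leftRename, hk]
  · have h1 : (4 * (k / 2) + 1) % 2 ≠ 0 := by omega
    have h2 : (4 * (k / 2) + 1) / 2 % 2 = 0 := by omega
    have h3 : (4 * (k / 2) + 1) / 2 / 2 = k / 2 := by omega
    simp only [Function.comp, interleave, leftRename, hk, h1, h2, h3, if_true, if_false]

theorem interleave_comp_right (e p q : ℕ → α) :
    interleave e (interleave p q) ∘ rightRename = interleave e q := by
  funext k
  by_cases hk : k % 2 = 0
  · simp [interleave, rightRename, hk]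
  · have h1 : (4 * (k / 2) + 3) % 2 ≠ 0 := by omega
    have h2 : (4 * (k / 2) + 3) / 2 % 2 ≠ 0 := by omega
    have h3 : (4 * (k / 2) + 3) / 2 / 2 = k / 2 := by omega
    simp only [Function.comp, interleave, rightRename, hk, h1, h2, h3, if_false]

theorem interleave_even (p q : ℕ → α) : (interleave p q ∘ fun k => 2 * k) = p := by
  funext k
  have h1 : 2 * k % 2 = 0 := by omega
  have h2 : 2 * k / 2 = k := by omega
  simp only [Function.comp, interleave, h1, h2, if_true]

theorem interleave_odd (p q : ℕ → α) : (interleave p q ∘ fun k => 2 * k + 1) = q := by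
  funext k
  have h1 : (2 * k + 1) % 2 ≠ 0 := by omega
  have h2 : (2 * k + 1) / 2 = k := by omega
  simp only [Function.comp, interleave, h1, h2, if_false]

theorem push_interleave (x : α) (e p : ℕ → α) :
    push x (interleave e p) ∘ binderRename = interleave (push x e) p := by
  funext k
  rcases Nat.even_or_odd' k with ⟨j, rfl | rfl⟩
  · cases j with
    | zero => rfl
    | succ j =>
      have h1 : 2 * (j + 1) % 2 = 0 := by omega
      have h2 : 2 * (j + 1) / 2 = j + 1 := by omega
      have h3 : 2 * (j + 1) - 1 = 2 * j + 1 := by omega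
      have h4 : 2 * j % 2 = 0 := by omega
      have h5 : 2 * j / 2 = j := by omega
      simp only [Function.comp, interleave, binderRename, h1, h2, h3, if_true,
        show 2 * (j + 1) ≠ 0 by omega, if_false, push, h4, h5]
  · have h1 : (2 * j + 1) % 2 ≠ 0 := by omega
    have h2 : (2 * j + 1) / 2 = j := by omega
    simp only [Function.comp, interleave, binderRename, h1, h2, push, if_false,
      show 2 * j + 1 ≠ 0 by omega]

end

variable {M : Type u} [L2Structure M]

/-- `t` is given by a numerical term with parameters. -/
class TermDef (t : (ℕ → M) → M) : Prop where
  out : ∃ (τ : Term) (p : ℕ → M), ∀ e, t e = τ.val (interleave e p)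

/-- `P` is given by a `Σ⁰₀` formula with parameters. -/
class Sigma0 (P : (ℕ → M) → Prop) : Prop where
  out : ∃ (φ : Formula) (p : ℕ → M) (E : ℕ → Set M), φ.IsSigma00 ∧
    (∀ k, E k ∈ L2Structure.sets) ∧ ∀ e, P e ↔ φ.Holds (interleave e p) E

/-- `X` belongs to the second-order part. -/
class InSets (X : Set M) : Prop where
  out : X ∈ L2Structure.sets

theorem TermDef.common (t s : (ℕ → M) → M) [ht : TermDef t] [hs : TermDef s] :
    ∃ (τ τ' : Term) (p : ℕ → M), (∀ e, t e = τ.val (interleave e p)) ∧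
      ∀ e, s e = τ'.val (interleave e p) := by
  obtain ⟨τ, p, h⟩ := ht.out
  obtain ⟨τ', p', h'⟩ := hs.out
  refine ⟨τ.rename leftRename, τ'.rename rightRename, interleave p p', fun e => ?_, fun e => ?_⟩
  · rw [Term.val_rename, interleave_comp_left, h]
  · rw [Term.val_rename, interleave_comp_right, h']

theorem Sigma0.common (P Q : (ℕ → M) → Prop) [hP : Sigma0 P] [hQ : Sigma0 Q] :
    ∃ (φ ψ : Formula) (p : ℕ → M) (E : ℕ → Set M), φ.IsSigma00 ∧ ψ.IsSigma00 ∧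
      (∀ k, E k ∈ L2Structure.sets) ∧ (∀ e, P e ↔ φ.Holds (interleave e p) E) ∧
      ∀ e, Q e ↔ ψ.Holds (interleave e p) E := by
  obtain ⟨φ, p, E, hφ, hE, h⟩ := hP.out
  obtain ⟨ψ, p', E', hψ, hE', h'⟩ := hQ.out
  refine ⟨φ.rename leftRename (2 * ·), ψ.rename rightRename (2 * · + 1), interleave p p',
    interleave E E', hφ.rename _ _, hψ.rename _ _, fun k => ?_, fun e => ?_, fun e => ?_⟩
  · unfold interleave
    split_ifs
    exacts [hE _, hE' _]
  · rw [Formula.holds_rename, interleave_comp_left, interleave_even, h]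
  · rw [Formula.holds_rename, interleave_comp_right, interleave_odd, h']

theorem exists_setAssignment : ∃ E : ℕ → Set M, ∀ k, E k ∈ L2Structure.sets := by
  obtain ⟨X, hX⟩ := L2Structure.sets_nonempty (M := M)
  exact ⟨fun _ => X, fun _ => hX⟩

/-! ### Closure properties of `Σ⁰₀` predicates -/

section Closure

variable {t s : (ℕ → M) → M} {P Q : (ℕ → M) → Prop}

instance TermDef.const (c : M) : TermDef fun _ => c :=
  ⟨.var 1, fun _ => c, fun _ => rfl⟩

instance TermDef.var (i : ℕ) : TermDef fun e : ℕ → M => e i :=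
  ⟨.var (2 * i), fun _ => 0, fun e => (congrFun (interleave_even e fun _ => 0) i).symm⟩

instance TermDef.add [TermDef t] [TermDef s] : TermDef fun e => t e + s e := by
  obtain ⟨τ, τ', p, h, h'⟩ := TermDef.common t s
  exact ⟨.add τ τ', p, fun e => by rw [h, h']; rfl⟩

instance TermDef.mul [TermDef t] [TermDef s] : TermDef fun e => t e * s e := by
  obtain ⟨τ, τ', p, h, h'⟩ := TermDef.common t s
  exact ⟨.mul τ τ', p, fun e => by rw [h, h']; rfl⟩

instance TermDef.pair [TermDef t] [TermDef s] : TermDef fun e => pair (t e) (s e) := by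
  unfold SecondOrderArithmetic.pair
  infer_instance

instance Sigma0.eq [TermDef t] [TermDef s] : Sigma0 fun e => t e = s e := by
  obtain ⟨τ, τ', p, h, h'⟩ := TermDef.common t s
  obtain ⟨E, hE⟩ := exists_setAssignment (M := M)
  exact ⟨.eq τ τ', p, E, .eq _ _, hE, fun e => by rw [h, h']; rfl⟩

instance Sigma0.lt [TermDef t] [TermDef s] : Sigma0 fun e => t e < s e := by
  obtain ⟨τ, τ', p, h, h'⟩ := TermDef.common t s
  obtain ⟨E, hE⟩ := exists_setAssignment (M := M)
  exact ⟨.lt τ τ', p, E, .lt _ _, hE, fun e => by rw [h, h']; rfl⟩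

instance Sigma0.mem [ht : TermDef t] {X : Set M} [hX : InSets X] : Sigma0 fun e => t e ∈ X := by
  obtain ⟨τ, p, h⟩ := ht.out
  exact ⟨.mem τ 0, p, fun _ => X, .mem _ _, fun _ => hX.out, fun e => by rw [h]; rfl⟩

instance Sigma0.imp [Sigma0 P] [Sigma0 Q] : Sigma0 fun e => P e → Q e := by
  obtain ⟨φ, ψ, p, E, hφ, hψ, hE, h, h'⟩ := Sigma0.common P Q
  exact ⟨.imp φ ψ, p, E, .imp hφ hψ, hE, fun e => by rw [h, h']; rfl⟩

instance Sigma0.not [hP : Sigma0 P] : Sigma0 fun e => ¬ P e := by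
  obtain ⟨φ, p, E, hφ, hE, h⟩ := hP.out
  exact ⟨.neg φ, p, E, .neg hφ, hE, fun e => by rw [h]; rfl⟩

theorem Sigma0.congr (hP : Sigma0 P) (h : ∀ e, Q e ↔ P e) : Sigma0 Q := by
  have : Q = P := funext fun e => propext (h e)
  rwa [this]

instance Sigma0.or [Sigma0 P] [Sigma0 Q] : Sigma0 fun e => P e ∨ Q e :=
  Sigma0.congr (P := fun e => ¬ P e → Q e) inferInstance fun _ => or_iff_not_imp_left

instance Sigma0.and [Sigma0 P] [Sigma0 Q] : Sigma0 fun e => P e ∧ Q e :=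
  Sigma0.congr (P := fun e => ¬ (P e → ¬ Q e)) inferInstance fun _ => by tauto

instance Sigma0.iff [Sigma0 P] [Sigma0 Q] : Sigma0 fun e => P e ↔ Q e :=
  Sigma0.congr (P := fun e => (P e → Q e) ∧ (Q e → P e)) inferInstance fun _ => by tauto

instance Sigma0.const (p : Prop) : Sigma0 fun _ : ℕ → M => p := by
  by_cases hp : p
  · exact Sigma0.congr (P := fun _ => (0 : M) = 0) inferInstance fun _ => by simp [hp]
  · exact Sigma0.congr (P := fun _ => ¬ (0 : M) = 0) inferInstance fun _ => by simp [hp]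

instance Sigma0.ballLT {P : M → (ℕ → M) → Prop} [ht : TermDef t]
    [hP : Sigma0 fun e => P (e 0) fun k => e (k + 1)] : Sigma0 fun e => ∀ x, x < t e → P x e := by
  obtain ⟨τ, p, h⟩ := ht.out
  obtain ⟨φ, q, E, hφ, hE, h'⟩ := hP.out
  refine ⟨Formula.ballLT (τ.rename leftRename) ((φ.rename rightRename id).rename binderRename id),
    interleave p q, E, .ballLT _ ((hφ.rename _ _).rename _ _), hE, fun e => ?_⟩
  refine forall_congr' fun x => imp_congr ?_ ?_
  · change _ ↔ x < (Term.shift _).val (push x _)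
    rw [Term.val_shift, Term.val_rename, interleave_comp_left, h]
  · rw [Formula.holds_rename, push_interleave, Formula.holds_rename, interleave_comp_right]
    exact h' (push x e)

instance Sigma0.bexLT {P : M → (ℕ → M) → Prop} [ht : TermDef t]
    [hP : Sigma0 fun e => P (e 0) fun k => e (k + 1)] : Sigma0 fun e => ∃ x, x < t e ∧ P x e :=
  Sigma0.congr (P := fun e => ¬ ∀ x, x < t e → ¬ P x e) inferInstance fun _ => by simp

theorem Sigma0.rename (hP : Sigma0 P) (ρ : ℕ → ℕ) : Sigma0 fun e => P fun k => e (ρ k) := by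
  obtain ⟨φ, p, E, hφ, hE, h⟩ := hP.out
  refine ⟨φ.rename (fun k => if k % 2 = 0 then 2 * ρ (k / 2) else k) id, p, E, hφ.rename _ _, hE,
    fun e => ?_⟩
  rw [Formula.holds_rename, h]
  refine iff_of_eq (congrArg₂ _ (funext fun k => ?_) rfl)
  by_cases hk : k % 2 = 0
  · have h1 : 2 * ρ (k / 2) % 2 = 0 := by omega
    have h2 : 2 * ρ (k / 2) / 2 = ρ (k / 2) := by omega
    simp only [interleave, Function.comp, hk, h1, h2, if_true]
  · simp only [interleave, Function.comp, hk, if_false]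

theorem TermDef.shift (ht : TermDef t) : TermDef fun e => t fun k => e (k + 1) := by
  obtain ⟨τ, p, h⟩ := ht.out
  refine ⟨τ.rename fun k => if k % 2 = 0 then k + 2 else k, p, fun e => ?_⟩
  rw [Term.val_rename, h]
  refine congrArg (fun e => Term.val e τ) (funext fun k => ?_)
  by_cases hk : k % 2 = 0
  · have h1 : (k + 2) % 2 = 0 := by omega
    have h2 : (k + 2) / 2 = k / 2 + 1 := by omega
    simp only [interleave, Function.comp, hk, h1, h2, if_true]
  · simp only [interleave, Function.comp, hk, if_false]

theorem Sigma0.support (hP : Sigma0 P) :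
    ∃ N : ℕ, ∀ e e' : ℕ → M, (∀ k < N, e k = e' k) → (P e ↔ P e') := by
  obtain ⟨φ, p, E, -, -, h⟩ := hP.out
  obtain ⟨N, hN⟩ := φ.holds_support (M := M)
  refine ⟨N, fun e e' he => ?_⟩
  rw [h, h]
  refine hN _ _ _ fun k hk => ?_
  unfold interleave
  split_ifs
  · exact he _ (lt_of_le_of_lt (Nat.div_le_self _ _) hk)
  · rfl

end Closure

section

variable [ModelRCA0 M]

instance Sigma0.le {t s : (ℕ → M) → M} [TermDef t] [TermDef s] : Sigma0 fun e => t e ≤ s e :=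
  Sigma0.congr (P := fun e => ¬ s e < t e) inferInstance fun _ => not_lt.symm

instance Sigma0.ballLE {t : (ℕ → M) → M} {P : M → (ℕ → M) → Prop} [TermDef t]
    [Sigma0 fun e => P (e 0) fun k => e (k + 1)] : Sigma0 fun e => ∀ x, x ≤ t e → P x e :=
  Sigma0.congr (P := fun e => ∀ x, x < t e + 1 → P x e) inferInstance
    fun _ => by simp only [lt_add_one_iff]

instance Sigma0.bexLE {t : (ℕ → M) → M} {P : M → (ℕ → M) → Prop} [TermDef t]
    [Sigma0 fun e => P (e 0) fun k => e (k + 1)] : Sigma0 fun e => ∃ x, x ≤ t e ∧ P x e :=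
  Sigma0.congr (P := fun e => ∃ x, x < t e + 1 ∧ P x e) inferInstance
    fun _ => by simp only [lt_add_one_iff]

instance Sigma0.dvd {t s : (ℕ → M) → M} [ht : TermDef t] [hs : TermDef s] :
    Sigma0 fun e => t e ∣ s e := by
  have := ht.shift
  have := hs.shift
  refine Sigma0.congr (P := fun e => ∃ q, q ≤ s e ∧ s e = t e * q) inferInstance fun e => ?_
  constructor
  · rintro ⟨q, hq⟩
    rcases eq_or_ne (t e) 0 with h | h
    · exact ⟨0, zero_le, by rw [hq, h]; simp⟩
    · exact ⟨q, hq ▸ le_mul_of_one_le_left' (one_le_of_pos (pos_iff_ne_zero.2 h)), hq⟩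
  · rintro ⟨q, -, hq⟩
    exact ⟨q, hq⟩

/-- A bounded quantifier over `x ≤ t` with `x = t` replaces syntactic substitution. -/
theorem Sigma0.comp {P : M → Prop} (hP : Sigma0 fun e => P (e 0)) (t : (ℕ → M) → M)
    [ht : TermDef t] : Sigma0 fun e => P (t e) := by
  have := ht.shift
  have : Sigma0 fun e : ℕ → M => P (e 0) := hP
  exact Sigma0.congr (P := fun e => ∃ x, x ≤ t e ∧ x = t e ∧ P x) inferInstance
    fun e => ⟨fun h => ⟨_, le_rfl, rfl, h⟩, by rintro ⟨_, -, rfl, h⟩; exact h⟩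

theorem Sigma0.comp₂ {P : M → M → Prop} (hP : Sigma0 fun e => P (e 0) (e 1))
    (t s : (ℕ → M) → M) [ht : TermDef t] [hs : TermDef s] : Sigma0 fun e => P (t e) (s e) := by
  have := ht.shift
  have := hs.shift
  have := hs.shift.shift
  have : Sigma0 fun e : ℕ → M => P (e 1) (e 0) :=
    hP.rename fun k => if k = 0 then 1 else 0
  exact Sigma0.congr
    (P := fun e => ∃ x, x ≤ t e ∧ x = t e ∧ ∃ y, y ≤ s e ∧ y = s e ∧ P x y) inferInstance
    fun e => ⟨fun h => ⟨_, le_rfl, rfl, _, le_rfl, rfl, h⟩,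
      by rintro ⟨_, -, rfl, _, -, rfl, h⟩; exact h⟩

theorem Sigma0.comp₃ {P : M → M → M → Prop} (hP : Sigma0 fun e => P (e 0) (e 1) (e 2))
    (t s r : (ℕ → M) → M) [ht : TermDef t] [hs : TermDef s] [hr : TermDef r] :
    Sigma0 fun e => P (t e) (s e) (r e) := by
  have := ht.shift
  have := hs.shift
  have := hs.shift.shift
  have := hr.shift
  have := hr.shift.shift
  have := hr.shift.shift.shift
  have : Sigma0 fun e : ℕ → M => P (e 2) (e 1) (e 0) :=
    hP.rename fun k => if k = 0 then 2 else if k = 1 then 1 else 0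
  exact Sigma0.congr
    (P := fun e => ∃ x, x ≤ t e ∧ x = t e ∧ ∃ y, y ≤ s e ∧ y = s e ∧
      ∃ z, z ≤ r e ∧ z = r e ∧ P x y z)
    inferInstance
    fun e => ⟨fun h => ⟨_, le_rfl, rfl, _, le_rfl, rfl, _, le_rfl, rfl, h⟩,
      by rintro ⟨_, -, rfl, _, -, rfl, _, -, rfl, h⟩; exact h⟩

/-! ### The schemes in semantic form -/

/-- The renaming that turns a predicate of the variables `0, 1` with parameters into the shape of
an instance of a scheme. -/
def schemeRename (k : ℕ) : ℕ := if k % 2 = 0 then (if k = 0 then 1 else 0) else k / 2 + 2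

theorem push_push_comp_schemeRename {α : Type*} (n y : α) (p : ℕ → α) :
    push y (push n p) ∘ schemeRename = interleave (push n fun _ => y) p := by
  funext k
  rcases Nat.even_or_odd' k with ⟨j, rfl | rfl⟩
  · have h1 : 2 * j % 2 = 0 := by omega
    have h2 : 2 * j / 2 = j := by omega
    cases j with
    | zero => rfl
    | succ j =>
      simp only [Function.comp, schemeRename, interleave, h1, h2, if_true, if_false,
        show 2 * (j + 1) ≠ 0 by omega, push]
  · have h1 : (2 * j + 1) % 2 ≠ 0 := by omega
    have h2 : (2 * j + 1) / 2 = j := by omega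
    simp only [Function.comp, schemeRename, interleave, h1, h2, if_false, push]

theorem sigma_induction (P : M → M → Prop) [hP : Sigma0 fun e => P (e 0) (e 1)]
    (h0 : ∃ y, P 0 y) (hs : ∀ n, (∃ y, P n y) → ∃ y, P (n + 1) y) (n : M) : ∃ y, P n y := by
  obtain ⟨φ, p, E, hφ, hE, h⟩ := hP.out
  have key : ∀ n, (Formula.ex (φ.rename schemeRename id)).Holds (push n p) E ↔ ∃ y, P n y := by
    intro n
    simp only [Formula.ex, Formula.Holds, Formula.holds_rename, push_push_comp_schemeRename,
      not_forall, not_not]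
    exact exists_congr fun y => (h (push n fun _ => y)).symm
  have := ModelRCA0.out.sigma01_induction (M := M) _ ⟨_, hφ.rename schemeRename id, rfl⟩ p E hE
  simp only [key] at this
  exact this h0 hs n

theorem delta_comprehension (P Q : M → M → Prop) [Sigma0 fun e => P (e 0) (e 1)]
    [Sigma0 fun e => Q (e 0) (e 1)] (h : ∀ n, (∃ y, P n y) ↔ ∀ y, Q n y) :
    {n : M | ∃ y, P n y} ∈ L2Structure.sets := by
  obtain ⟨φ, ψ, p, E, hφ, hψ, hE, h₁, h₂⟩ :=
    Sigma0.common (fun e : ℕ → M => P (e 0) (e 1)) fun e => Q (e 0) (e 1)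
  have key₁ : ∀ n, (Formula.ex (φ.rename schemeRename id)).Holds (push n p) E ↔ ∃ y, P n y := by
    intro n
    simp only [Formula.ex, Formula.Holds, Formula.holds_rename, push_push_comp_schemeRename,
      not_forall, not_not]
    exact exists_congr fun y => (h₁ (push n fun _ => y)).symm
  have key₂ : ∀ n, (Formula.all (ψ.rename schemeRename id)).Holds (push n p) E ↔ ∀ y, Q n y := by
    intro n
    simp only [Formula.Holds, Formula.holds_rename, push_push_comp_schemeRename]
    exact forall_congr' fun y => (h₂ (push n fun _ => y)).symm
  obtain ⟨X, hX, hX'⟩ := ModelRCA0.out.delta01_comprehension (M := M) _ _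
    ⟨_, hφ.rename schemeRename id, rfl⟩ ⟨_, hψ.rename schemeRename id, rfl⟩ p E hE
    fun n => by rw [key₁, key₂, h]
  have : {n : M | ∃ y, P n y} = X := by
    ext n
    rw [hX', key₁]
    rfl
  rwa [this]

theorem setOf_mem_sets (P : M → Prop) [Sigma0 fun e => P (e 0)] :
    {n : M | P n} ∈ L2Structure.sets := by
  have := delta_comprehension (fun n _ => P n) (fun n _ => P n) fun n => by simp
  simpa using this

theorem induction_on (P : M → Prop) [Sigma0 fun e => P (e 0)] (h0 : P 0)
    (hs : ∀ n, P n → P (n + 1)) (n : M) : P n := by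
  have := sigma_induction (fun n _ => P n) ⟨0, h0⟩ (fun n ⟨_, h⟩ => ⟨0, hs n h⟩) n
  exact this.elim fun _ h => h

/-- The least number principle for `Σ⁰₁` predicates. -/
theorem exists_least (P : M → M → Prop) [hP : Sigma0 fun e => P (e 0) (e 1)]
    (h : ∃ n y, P n y) : ∃ n, (∃ y, P n y) ∧ ∀ n', n' < n → ¬ ∃ y, P n' y := by
  obtain ⟨N, y, hy⟩ := h
  by_contra! hc
  have hD := hP.comp₂
  -- Without a least element one can descend from `N` any number `i` of times. The bound `w` merges
  -- the quantifiers over `z` and `y` into one, so this is a `Σ⁰₁` induction; `i = N + 1` is absurd.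
  have key : ∀ i, ∃ w, ∃ z, z ≤ w ∧ ∃ y, y ≤ w ∧ z + i ≤ N ∧ P z y := by
    refine sigma_induction _ ⟨max N y, N, le_max_left _ _, y, le_max_right _ _, by simp, hy⟩ ?_
    rintro i ⟨w, z, -, y, -, hz, hy⟩
    obtain ⟨z', hz', y', hy'⟩ := hc z ⟨y, hy⟩
    refine ⟨max z' y', z', le_max_left _ _, y', le_max_right _ _, ?_, hy'⟩
    have := add_one_le_iff.2 hz'
    calc z' + (i + 1) = z' + 1 + i := by ring
      _ ≤ z + i := add_le_add this le_rfl
      _ ≤ N := hz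
  obtain ⟨w, z, -, y, -, hz, -⟩ := key (N + 1)
  exact absurd (le_add_self.trans hz) (not_le.2 (lt_add_one N))

theorem exists_least' (P : M → Prop) [Sigma0 fun e => P (e 0)] (h : ∃ n, P n) :
    ∃ n, P n ∧ ∀ n', n' < n → ¬ P n' := by
  obtain ⟨n, hn⟩ := h
  obtain ⟨m, ⟨_, hm⟩, hm'⟩ := exists_least (fun n _ => P n) ⟨n, 0, hn⟩
  exact ⟨m, hm, fun n' hn' h => hm' n' hn' ⟨0, h⟩⟩

/-- The least upper bound of the solutions up to `b` is attained, since otherwise its predecessor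
would be an upper bound too. -/
theorem exists_greatest (P : M → Prop) [hP : Sigma0 fun e => P (e 0)] (b : M)
    (h : ∃ n, n ≤ b ∧ P n) :
    ∃ n, n ≤ b ∧ P n ∧ ∀ n', n' ≤ b → P n' → n' ≤ n := by
  obtain ⟨n, hn, hPn⟩ := h
  have hD := hP.comp
  obtain ⟨m, hm, hm'⟩ := exists_least' (fun m : M => ∀ n, n ≤ b → P n → n ≤ m) ⟨b, fun n hn _ => hn⟩
  have hmem : m ≤ b ∧ P m := by
    by_contra hc
    rcases eq_zero_or_succ m with rfl | ⟨k, rfl⟩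
    · have : n = 0 := le_antisymm (hm n hn hPn) (zero_le)
      exact hc (this ▸ ⟨hn, hPn⟩)
    · refine hm' k (lt_add_one k) fun n' hn' hPn' =>
        lt_add_one_iff.1 (lt_of_le_of_ne (hm n' hn' hPn') ?_)
      rintro rfl
      exact hc ⟨hn', hPn'⟩
  exact ⟨m, hmem.1, hmem.2, hm⟩

end

end SecondOrderArithmetic

namespace SecondOrderArithmetic

universe u

set_option linter.unusedSectionVars false
set_option synthInstance.maxSize 100000
set_option synthInstance.maxHeartbeats 400000

variable {M : Type u} [L2Structure M] [ModelRCA0 M]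

/-! ### Codes of finite sets -/

theorem dvd_of_dvd_add {d x y : M} (hx : d ∣ x) (h : d ∣ x + y) : d ∣ y := by
  obtain ⟨q, rfl⟩ := hx
  obtain ⟨r, hr⟩ := h
  rcases le_total q r with hq | hq
  · obtain ⟨z, rfl⟩ := exists_add_of_le hq
    rw [mul_add] at hr
    exact ⟨z, add_left_cancel hr⟩
  · have h1 : d * q + y ≤ d * q := hr.le.trans (mul_le_mul' le_rfl hq)
    have h2 : y = 0 := by
      by_contra hy
      exact absurd h1 (not_le.2 (lt_add_of_pos_right _ (pos_iff_ne_zero.2 hy)))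
    exact h2 ▸ dvd_zero d

/-- Distinct moduli of the form `m (i + 1) + 1` are coprime if `m` has enough divisors. -/
theorem dvd_of_dvd_mul_modulus {m k i j a : M} (hm : ∀ i, i < k → i + 1 ∣ m) (hi : i < k)
    (hj : j < k) (hij : i ≠ j) (h : m * (j + 1) + 1 ∣ a * (m * (i + 1) + 1)) :
    m * (j + 1) + 1 ∣ a := by
  obtain ⟨z, hz, hzm⟩ : ∃ z, (i = j + z ∨ j = i + z) ∧ z ∣ m := by
    rcases lt_or_gt_of_ne hij with h' | h'
    · obtain ⟨z, rfl⟩ := exists_add_of_le h'.le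
      refine ⟨z, Or.inr rfl, ?_⟩
      rcases eq_zero_or_succ z with rfl | ⟨y, rfl⟩
      · simp at h'
      · exact hm y ((lt_add_one y).trans (lt_of_le_of_lt le_add_self hj))
    · obtain ⟨z, rfl⟩ := exists_add_of_le h'.le
      refine ⟨z, Or.inl rfl, ?_⟩
      rcases eq_zero_or_succ z with rfl | ⟨y, rfl⟩
      · simp at h'
      · exact hm y ((lt_add_one y).trans (lt_of_le_of_lt le_add_self hi))
  -- Cross-multiplication eliminates `m`: the products `(i + 1)(m(j + 1) + 1)` and `(j + 1)(m(i + 1)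
  -- + 1)` differ by exactly `z`. Then `z ∣ m` turns divisibility of `a * z` into divisibility of `a
  -- * m * (j + 1)`, which is `a` short of a multiple of the modulus.
  have h1 : m * (j + 1) + 1 ∣ a * z := by
    rcases hz with rfl | rfl
    · have : m * (j + 1) + 1 ∣ a * (j + 1 + z) * (m * (j + 1) + 1) + a * z := by
        have e : a * (j + 1 + z) * (m * (j + 1) + 1) =
            (j + 1) * (a * (m * (j + z + 1) + 1)) + a * z := by ring
        have e' : (j + 1) * (a * (m * (j + z + 1) + 1)) + a * z + a * z = 
          a * (j + 1 + z) * (m * (j + 1) + 1) + a * z := by rw [e]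
        have : m * (j + 1) + 1 ∣ a * z := dvd_of_dvd_add (dvd_mul_of_dvd_right h (j + 1))
          (e ▸ dvd_mul_left _ _)
        exact dvd_add (dvd_mul_left _ _) this
      exact dvd_of_dvd_add (dvd_mul_left _ _) this
    · have e : (i + z + 1) * (a * (m * (i + 1) + 1)) =
          a * (i + 1) * (m * (i + z + 1) + 1) + a * z := by ring
      exact dvd_of_dvd_add (dvd_mul_left _ _) (e ▸ dvd_mul_of_dvd_right h (i + z + 1))
  have h2 : m * (j + 1) + 1 ∣ a * m * (j + 1) := by
    obtain ⟨w, rfl⟩ := hzm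
    have e : a * (z * w) * (j + 1) = a * z * (w * (j + 1)) := by ring
    exact e ▸ dvd_mul_of_dvd_left h1 _
  have e : a * m * (j + 1) + a = a * (m * (j + 1) + 1) := by ring
  exact dvd_of_dvd_add h2 (e ▸ dvd_mul_left _ _)

theorem exists_common_multiple (k : M) : ∃ m : M, 0 < m ∧ ∀ i, i < k → i + 1 ∣ m := by
  refine sigma_induction (fun k m => 0 < m ∧ ∀ i, i < k → i + 1 ∣ m)
    ⟨1, zero_lt_one, fun i hi => absurd hi (not_lt.2 zero_le)⟩ ?_ k
  rintro n ⟨m, h0, hm⟩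
  refine ⟨m * (n + 1), mul_pos h0 (lt_of_lt_of_le zero_lt_one le_add_self), fun i hi => ?_⟩
  rcases eq_or_lt_of_le (lt_add_one_iff.1 hi) with rfl | hi
  · exact dvd_mul_left _ _
  · exact dvd_mul_of_dvd_left (hm i hi) _

theorem modulus_not_dvd_one {m : M} (hm : 0 < m) (i : M) : ¬ m * (i + 1) + 1 ∣ 1 := by
  rintro ⟨q, hq⟩
  have hq0 : q ≠ 0 := by
    rintro rfl
    simp at hq
  have h1 : m * (i + 1) + 1 ≤ 1 :=
    (le_mul_of_one_le_right' (one_le_of_pos (pos_iff_ne_zero.2 hq0))).trans hq.ge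
  have h2 : 0 < m * (i + 1) := mul_pos hm (lt_of_lt_of_le zero_lt_one le_add_self)
  exact absurd h1 (not_le.2 (lt_add_of_pos_left _ h2))

/-- The number `n` is the product of the moduli of all `i < k` with `P i`, built one factor at a
time by `Σ⁰₁` induction. By coprimality a new factor makes no other modulus a divisor. -/
theorem exists_dvd_iff (P : M → Prop) [hP : Sigma0 fun e => P (e 0)] {m k : M} (hm0 : 0 < m)
    (hm : ∀ i, i < k → i + 1 ∣ m) :
    ∃ n : M, 0 < n ∧ ∀ i, i < k → (m * (i + 1) + 1 ∣ n ↔ P i) := by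
  have hP' := hP.comp
  obtain ⟨n, hn0, hn⟩ := sigma_induction
    (fun l n => 0 < n ∧ ∀ i, i < k → (m * (i + 1) + 1 ∣ n ↔ i < l ∧ P i))
    ⟨1, zero_lt_one, fun i _ => iff_of_false (modulus_not_dvd_one hm0 i)
      fun h => absurd h.1 (not_lt.2 zero_le)⟩
    (fun l ⟨n, hn0, hn⟩ => by
      by_cases hl : l < k ∧ P l
      · refine ⟨n * (m * (l + 1) + 1), mul_pos hn0 (lt_of_lt_of_le zero_lt_one le_add_self),
          fun i hi => ?_⟩
        rcases eq_or_ne l i with rfl | hli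
        · exact iff_of_true (dvd_mul_left _ _) ⟨lt_add_one _, hl.2⟩
        · have : m * (i + 1) + 1 ∣ n * (m * (l + 1) + 1) ↔ m * (i + 1) + 1 ∣ n :=
            ⟨dvd_of_dvd_mul_modulus hm hl.1 hi hli, fun h => dvd_mul_of_dvd_left h _⟩
          rw [this, hn i hi, lt_add_one_iff, le_iff_lt_or_eq]
          simp [hli.symm]
      · refine ⟨n, hn0, fun i hi => ?_⟩
        rw [hn i hi, lt_add_one_iff, le_iff_lt_or_eq]
        constructor
        · exact fun h => ⟨Or.inl h.1, h.2⟩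
        · rintro ⟨h | rfl, h'⟩
          · exact ⟨h, h'⟩
          · exact absurd ⟨hi, h'⟩ hl) k
  exact ⟨n, hn0, fun i hi => by rw [hn i hi, and_iff_right hi]⟩

theorem finMem_iff {k m n i : M} :
    FinMem i (pair k (pair m n)) ↔ i < k ∧ m * (i + 1) + 1 ∣ n := by
  constructor
  · rintro ⟨k', m', n', h, hi, hq⟩
    obtain ⟨rfl, h'⟩ := pair_inj.1 h
    obtain ⟨rfl, rfl⟩ := pair_inj.1 h'
    exact ⟨hi, hq⟩
  · rintro ⟨hi, hq⟩
    exact ⟨k, m, n, rfl, hi, hq⟩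

theorem FinMem.lt {i c : M} (h : FinMem i c) : i < c := by
  obtain ⟨k, m, n, rfl, hi, -⟩ := h
  exact lt_of_lt_of_le hi (left_le_pair _ _)

instance Sigma0.isTriple {t : (ℕ → M) → M} [ht : TermDef t] : Sigma0 fun e => IsTriple (t e) := by
  refine Sigma0.comp (P := IsTriple) (Sigma0.congr
    (P := fun e : ℕ → M => ∃ k, k ≤ e 0 ∧ ∃ m, m ≤ e 0 ∧ ∃ n, n ≤ e 0 ∧ e 0 = pair k (pair m n))
    (by infer_instance) fun e => ?_) t
  constructor
  · rintro ⟨k, m, n, h⟩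
    rw [h]
    exact ⟨k, left_le_pair _ _, m, (left_le_pair _ _).trans (right_le_pair _ _), n,
      (right_le_pair _ _).trans (right_le_pair _ _), rfl⟩
  · rintro ⟨k, -, m, -, n, -, h⟩
    exact ⟨k, m, n, h⟩

instance Sigma0.finMem {t s : (ℕ → M) → M} [TermDef t] [TermDef s] :
    Sigma0 fun e => FinMem (t e) (s e) := by
  refine Sigma0.comp₂ (P := FinMem) (Sigma0.congr
    (P := fun e : ℕ → M => ∃ k, k ≤ e 1 ∧ ∃ m, m ≤ e 1 ∧ ∃ n, n ≤ e 1 ∧ (e 1 = pair k (pair m n) ∧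
      (e 0 < k ∧ m * (e 0 + 1) + 1 ∣ n))) (by infer_instance) fun e => ?_) t s
  constructor
  · rintro ⟨k, m, n, h, hi, hq⟩
    rw [h]
    exact ⟨k, left_le_pair _ _, m, (left_le_pair _ _).trans (right_le_pair _ _), n,
      (right_le_pair _ _).trans (right_le_pair _ _), rfl, hi, hq⟩
  · rintro ⟨k, -, m, -, n, -, h, hi, hq⟩
    exact ⟨k, m, n, h, hi, hq⟩

/-- `c` and `d` represent the same finite set. -/
def SameElements (c d : M) : Prop := ∀ i, FinMem i c ↔ FinMem i d

instance Sigma0.sameElements {t s : (ℕ → M) → M} [TermDef t] [TermDef s] :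
    Sigma0 fun e => SameElements (t e) (s e) := by
  refine Sigma0.comp₂ (P := SameElements) (Sigma0.congr
    (P := fun e : ℕ → M => (∀ i, i < e 0 → FinMem i (e 0) → FinMem i (e 1)) ∧
      ∀ i, i < e 1 → FinMem i (e 1) → FinMem i (e 0)) (by infer_instance) fun e => ?_) t s
  exact ⟨fun h => ⟨fun i _ => (h i).1, fun i _ => (h i).2⟩,
    fun h i => ⟨fun hi => h.1 i hi.lt hi, fun hi => h.2 i hi.lt hi⟩⟩

instance Sigma0.isFinCode {t : (ℕ → M) → M} [TermDef t] : Sigma0 fun e => IsFinCode (t e) := by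
  refine Sigma0.comp (P := IsFinCode) (Sigma0.congr
    (P := fun e : ℕ → M => IsTriple (e 0) ∧
      ∀ d, d < e 0 → IsTriple d → ¬ SameElements d (e 0)) (by infer_instance) fun e => Iff.rfl) t

/-- `c` is the code of the set `X`. -/
def Codes (c : M) (X : Set M) : Prop := IsFinCode c ∧ ∀ i, FinMem i c ↔ i ∈ X

theorem Codes.unique {c d : M} {X : Set M} (hc : Codes c X) (hd : Codes d X) : c = d := by
  have h : ∀ i, FinMem i c ↔ FinMem i d := fun i => (hc.2 i).trans (hd.2 i).symm
  rcases lt_trichotomy c d with h' | h' | h'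
  · exact absurd h (hd.1.2 c h' hc.1.1)
  · exact h'
  · exact absurd (fun i => (h i).symm) (hc.1.2 d h' hd.1.1)

theorem exists_codes (P : M → Prop) [hP : Sigma0 fun e => P (e 0)] (k : M)
    (hk : ∀ i, P i → i < k) : ∃ c : M, Codes c {i | P i} := by
  obtain ⟨m, hm0, hm⟩ := exists_common_multiple k
  obtain ⟨n, -, hn⟩ := exists_dvd_iff P hm0 hm
  have h1 : ∀ i, FinMem i (pair k (pair m n)) ↔ P i := fun i => by
    rw [finMem_iff]
    exact ⟨fun h => (hn i h.1).1 h.2, fun h => ⟨hk i h, (hn i (hk i h)).2 h⟩⟩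
  obtain ⟨c, ⟨hc, hc'⟩, hmin⟩ := exists_least'
    (fun c => IsTriple c ∧ SameElements c (pair k (pair m n))) ⟨_, ⟨k, m, n, rfl⟩, fun _ => Iff.rfl⟩
  refine ⟨c, ⟨hc, fun d hd hd' hdc => hmin d hd ⟨hd', fun i => (hdc i).trans (hc' i)⟩⟩, fun i => ?_⟩
  rw [hc', h1]
  rfl

/-! ### Bounding -/

/-- Strong `Σ⁰₁` bounding. -/
theorem strong_bounding (P : M → M → Prop) [hP : Sigma0 fun e => P (e 0) (e 1)] (k : M) :
    ∃ b, ∀ y, y < k → (∃ i, P y i) → ∃ i, i < b ∧ P y i := by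
  have hP' := hP.comp₂
  obtain ⟨m, hm0, hm⟩ := exists_common_multiple k
  obtain ⟨a, ha0, ha⟩ := exists_dvd_iff (fun _ => True) hm0 hm
  -- The divisors of `n` cover all `y < k` that have no witness below `b`. If a minimal `n` still
  -- covered some `y` whose first witness comes later, raising `b` and dividing by the modulus of
  -- `y` would give a smaller `n`.
  obtain ⟨n, ⟨b, hn0, hb⟩, hmin⟩ := exists_least
    (fun n b => 0 < n ∧ ∀ y, y < k → (∀ i, i < b → ¬ P y i) → m * (y + 1) + 1 ∣ n)
    ⟨a, 0, ha0, fun y hy _ => (ha y hy).2 trivial⟩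
  refine ⟨b, fun y hy ⟨i, hi⟩ => ?_⟩
  by_contra! hc
  obtain ⟨n', rfl⟩ := hb y hy hc
  have hn' : 0 < n' := by
    rw [pos_iff_ne_zero]
    rintro rfl
    simp at hn0
  refine hmin n' ?_ ⟨max b (i + 1), hn', fun z hz hz' => ?_⟩
  · have h2 : 0 < m * (y + 1) := mul_pos hm0 (lt_of_lt_of_le zero_lt_one le_add_self)
    exact (lt_mul_iff_one_lt_left hn').2 (lt_add_of_pos_left _ h2)
  · have hzy : y ≠ z := by
      rintro rfl
      exact hz' i (lt_of_lt_of_le (lt_add_one i) (le_max_right _ _)) hi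
    refine dvd_of_dvd_mul_modulus hm hy hz hzy ?_
    rw [mul_comm n']
    exact hb z hz fun j hj => hz' j (lt_of_lt_of_le hj (le_max_left _ _))

/-- Bounded collection. -/
theorem collection (P : M → M → Prop) [hP : Sigma0 fun e => P (e 0) (e 1)] (k : M)
    (h : ∀ y, y < k → ∃ i, P y i) : ∃ b, ∀ y, y < k → ∃ i, i < b ∧ P y i := by
  obtain ⟨b, hb⟩ := strong_bounding P k
  exact ⟨b, fun y hy => hb y hy (h y hy)⟩

/-- A definable injective function takes only boundedly often values below a given bound. -/
theorem injective_unbounded (f : M → M) [hf : Sigma0 fun e => f (e 0) = e 1]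
    (hinj : Function.Injective f) (k : M) : ∃ b, ∀ i, b ≤ i → k ≤ f i := by
  have : Sigma0 fun e : ℕ → M => f (e 1) = e 0 := hf.rename fun k => if k = 0 then 1 else 0
  obtain ⟨b, hb⟩ := strong_bounding (fun y i => f i = y) k
  refine ⟨b, fun i hi => ?_⟩
  by_contra! hc
  obtain ⟨j, hj, hji⟩ := hb _ hc ⟨i, rfl⟩
  exact absurd hj (not_lt.2 (hinj hji ▸ hi))

/-! ### Arithmetical comprehension from `Σ⁰₁` comprehension -/

/-- Comprehension for `Σ⁰₁` formulas with parameters. -/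
def Sigma1Comprehension (M : Type u) [L2Structure M] : Prop :=
  ∀ P : M → M → Prop, (Sigma0 fun e => P (e 0) (e 1)) → {n : M | ∃ y, P n y} ∈ L2Structure.sets

theorem Sigma0.push_const {P : (ℕ → M) → Prop} (hP : Sigma0 P) (a : ℕ → M) :
    Sigma0 fun e => P (push (e 0) a) := by
  obtain ⟨φ, p, E, hφ, hE, h⟩ := hP.out
  refine ⟨φ.rename (fun k => if binderRename k = 0 then 0 else 2 * (binderRename k - 1) + 1) id,
    interleave a p, E, hφ.rename _ _, hE, fun e => ?_⟩
  rw [Formula.holds_rename, h, ← push_interleave]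
  refine iff_of_eq (congrArg₂ _ (funext fun k => ?_) rfl)
  simp only [Function.comp]
  rcases binderRename k with _ | j
  · rfl
  · have h1 : (2 * j + 1) % 2 ≠ 0 := by omega
    have h2 : (2 * j + 1) / 2 = j := by omega
    simp only [push, Nat.add_sub_cancel, show j + 1 ≠ 0 by omega, if_false]
    conv_rhs => unfold interleave
    simp only [h1, h2, if_false]
    rfl

/-- Under `Σ⁰₁` comprehension the class of definable predicates is closed under unbounded number
quantifiers. -/
theorem Sigma0.ex_of_support (hM : Sigma1Comprehension M) (N : ℕ) (P : (ℕ → M) → Prop)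
    (hP : Sigma0 P) (hN : ∀ e e' : ℕ → M, (∀ k < N + 2, e k = e' k) → (P e ↔ P e')) :
    Sigma0 fun e => ∃ x, P (push x e) := by
  induction N generalizing P with
  | zero =>
    have h1 : Sigma0 fun e : ℕ → M => P (push (e 1) (push (e 0) fun _ => 0)) := by
      refine (hP.rename fun k => if k = 0 then 1 else 0).congr fun e => hN _ _ fun k hk => ?_
      interval_cases k <;> rfl
    -- With a single free variable left, the quantified predicate is membership in a set supplied by
    -- `Σ⁰₁` comprehension, hence atomic.
    have : InSets {n : M | ∃ y, P (push y (push n fun _ => 0))} :=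
      ⟨hM (fun n y => P (push y (push n fun _ => 0))) h1⟩
    refine Sigma0.congr (P := fun e => e 0 ∈ {n : M | ∃ y, P (push y (push n fun _ => 0))})
      (by infer_instance) fun e => exists_congr fun x => hN _ _ fun k hk => ?_
    interval_cases k <;> rfl
  | succ N ih =>
    have h1 : Sigma0 fun e : ℕ → M =>
        P (push (e 2) (push (e 1) (push (e 0) fun k => e (k + 4)))) := by
      refine (hP.rename fun k => if k = 0 then 2 else if k = 1 then 1 else if k = 2 then 0 else
        k + 1).congr fun e => iff_of_eq (congrArg P (funext fun k => ?_))
      rcases k with _ | _ | _ | k <;> rfl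
    -- Two free variables `a`, `b` are packed into the code `e 1`, so the support shrinks by one and
    -- the induction hypothesis applies.
    have h2 : Sigma0 fun e : ℕ → M => ∃ a, a ≤ e 1 ∧ ∃ b, b ≤ e 1 ∧ (e 1 = pair a b ∧
        P (push (e 0) (push a (push b fun k => e (k + 2))))) := by
      infer_instance
    have h3 := ih _ h2 (by
      intro e e' h
      rw [h 0 (by omega), h 1 (by omega)]
      refine exists_congr fun a => and_congr_right fun _ => exists_congr fun b =>
        and_congr_right fun _ => and_congr_right fun _ => hN _ _ fun k hk => ?_
      rcases k with _ | _ | _ | k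
      · rfl
      · rfl
      · rfl
      · exact h (k + 2) (by omega))
    have h4 : Sigma0 fun e : ℕ → M => ∃ x, ∃ a, a ≤ e 0 ∧ ∃ b, b ≤ e 0 ∧ (e 0 = pair a b ∧
        P (push x (push a (push b fun k => e (k + 3))))) := by
      refine (h3.rename fun k => if k = 0 then 0 else k + 2).congr fun e => ?_
      rfl
    refine Sigma0.congr (P := fun e => ∃ c, c ≤ pair (e 0) (e 1) ∧ (c = pair (e 0) (e 1) ∧
      ∃ x, ∃ a, a ≤ c ∧ ∃ b, b ≤ c ∧ (c = pair a b ∧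
        P (push x (push a (push b fun k => e (k + 2))))))) (by infer_instance) fun e => ?_
    have h5 : push (e 0) (push (e 1) fun k => e (k + 2)) = e := by
      funext k
      rcases k with _ | _ | k <;> rfl
    constructor
    · rintro ⟨x, hx⟩
      exact ⟨_, le_rfl, rfl, x, e 0, left_le_pair _ _, e 1, right_le_pair _ _, rfl, h5.symm ▸ hx⟩
    · rintro ⟨_, -, rfl, x, a, -, b, -, hab, hx⟩
      obtain ⟨rfl, rfl⟩ := pair_inj.1 hab
      rw [h5] at hx
      exact ⟨x, hx⟩

theorem Sigma0.of_isArithmetical (hM : Sigma1Comprehension M) {φ : Formula}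
    (hφ : φ.IsArithmetical) {E : ℕ → Set M} (hE : ∀ k, E k ∈ L2Structure.sets) :
    Sigma0 fun e => φ.Holds e E := by
  have hvar : ∀ t : Term, TermDef fun e : ℕ → M => t.val e := by
    intro t
    induction t with
    | var i => exact TermDef.var i
    | zero => exact TermDef.const 0
    | one => exact TermDef.const 1
    | add t s iht ihs => exact TermDef.add
    | mul t s iht ihs => exact TermDef.mul
  induction φ with
  | eq t s => exact Sigma0.eq
  | lt t s => exact Sigma0.lt
  | mem t X =>
    have : InSets (E X) := ⟨hE X⟩
    exact Sigma0.mem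
  | neg φ ih =>
    have := ih hφ
    exact Sigma0.not
  | imp φ ψ ih₁ ih₂ =>
    have := ih₁ hφ.1
    have := ih₂ hφ.2
    exact Sigma0.imp
  | all φ ih =>
    have h := ih hφ
    have h' : Sigma0 fun e => ¬ φ.Holds e E := Sigma0.not
    obtain ⟨N, hN⟩ := h'.support
    have := Sigma0.ex_of_support hM N _ h' fun e e' he => hN e e' fun k hk => he k (by omega)
    exact Sigma0.congr (P := fun e => ¬ ∃ x, ¬ φ.Holds (push x e) E) (by infer_instance)
      fun e => by simp [Formula.Holds]
  | allSet φ ih => exact hφ.elim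

theorem isModelACA0_of_sigma1Comprehension (hM : Sigma1Comprehension M) : IsModelACA0 M where
  semiring := ModelRCA0.out.semiring
  induction X hX h0 hs := by
    have : InSets X := ⟨hX⟩
    exact induction_on (fun n => n ∈ X) h0 hs
  arithmetical_comprehension φ hφ e E hE := by
    have := (Sigma0.of_isArithmetical hM hφ hE).push_const e
    exact ⟨_, setOf_mem_sets fun n => φ.Holds (push n e) E, fun n => Iff.rfl⟩

/-! ### The quasi-order of an enumeration -/

/-- A definable injection whose values come in pairs of neighbours. -/
class PairedEnumeration (g : M → M) : Prop where
  graph : Sigma0 fun e => g (e 0) = e 1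
  less : Sigma0 fun e => g (e 0) < g (e 1)
  injective : Function.Injective g
  map_zero : g 0 = 0
  map_odd : ∀ r, g (r + r + 1) = g (r + r) + 1

/-- Some stage `k ≤ s` after `t` shows that the value at `t` is not minimal from `t` on. -/
def SeenFalse (g : M → M) (t s : M) : Prop := ∃ k, k ≤ s ∧ (t < k ∧ g k < g t)

/-- The linear order in which `t` precedes a later stage `s` if and only if `t` is seen to be
false at `s`. -/
def StageLe (g : M → M) (x y : M) : Prop :=
  x = y ∨ (x < y ∧ SeenFalse g x y) ∨ (y < x ∧ ¬ SeenFalse g y x)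

/-- Comparison of values, where `0` and `1` stand for two additional largest elements. -/
def ValueLe (g : M → M) (u w : M) : Prop := w = 1 ∨ (u ≠ 1 ∧ (w = 0 ∨ (u ≠ 0 ∧ ¬ g w < g u)))

/-! ### The orders of stages and of values -/

section

variable (g : M → M) [hg : PairedEnumeration g]

instance Sigma0.enumeration_graph {t s : (ℕ → M) → M} [TermDef t] [TermDef s] :
    Sigma0 fun e => g (t e) = s e :=
  Sigma0.comp₂ (P := fun a b => g a = b) hg.graph t s

instance Sigma0.enumeration_less {t s : (ℕ → M) → M} [TermDef t] [TermDef s] :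
    Sigma0 fun e => g (t e) < g (s e) :=
  Sigma0.comp₂ (P := fun a b => g a < g b) hg.less t s

instance Sigma0.seenFalse {t s : (ℕ → M) → M} [TermDef t] [TermDef s] :
    Sigma0 fun e => SeenFalse g (t e) (s e) := by
  refine Sigma0.comp₂ (P := SeenFalse g) ?_ t s
  unfold SeenFalse
  infer_instance

instance Sigma0.stageLe {t s : (ℕ → M) → M} [TermDef t] [TermDef s] :
    Sigma0 fun e => StageLe g (t e) (s e) := by
  unfold StageLe
  infer_instance

instance Sigma0.valueLe {t s : (ℕ → M) → M} [TermDef t] [TermDef s] :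
    Sigma0 fun e => ValueLe g (t e) (s e) := by
  unfold ValueLe
  infer_instance

variable {g}

theorem SeenFalse.mono {t s s' : M} (h : SeenFalse g t s) (hs : s ≤ s') : SeenFalse g t s' := by
  obtain ⟨k, hk, h⟩ := h
  exact ⟨k, hk.trans hs, h⟩

/-- Let `k` witness that `t` is false. If `k` comes after `s`, then either `g s < g t` and `s` is
itself a witness against `t`, or `g k < g t ≤ g s` and `k` is a witness against `s`. Transitivity of
`StageLe` rests on this. -/
theorem SeenFalse.or {t s r : M} (hts : t < s) (h : SeenFalse g t r) :
    SeenFalse g t s ∨ SeenFalse g s r := by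
  obtain ⟨k, hk, htk, hgk⟩ := h
  rcases le_or_gt k s with h' | h'
  · exact Or.inl ⟨k, h', htk, hgk⟩
  · rcases lt_or_ge (g s) (g t) with h'' | h''
    · exact Or.inl ⟨s, le_rfl, hts, h''⟩
    · exact Or.inr ⟨k, hk, h', hgk.trans_le h''⟩

theorem StageLe.refl (x : M) : StageLe g x x := Or.inl rfl

theorem StageLe.trans {x y z : M} (h₁ : StageLe g x y) (h₂ : StageLe g y z) : StageLe g x z := by
  rcases h₁ with rfl | ⟨hxy, h₁⟩ | ⟨hyx, h₁⟩
  · exact h₂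
  · rcases h₂ with rfl | ⟨hyz, h₂⟩ | ⟨hzy, h₂⟩
    · exact Or.inr (Or.inl ⟨hxy, h₁⟩)
    · exact Or.inr (Or.inl ⟨hxy.trans hyz, h₁.mono hyz.le⟩)
    · rcases lt_trichotomy x z with h | h | h
      · exact Or.inr (Or.inl ⟨h, (h₁.or h).resolve_right h₂⟩)
      · exact Or.inl h
      · exact Or.inr (Or.inr ⟨h, fun h' => h₂ (h'.mono hxy.le)⟩)
  · rcases h₂ with rfl | ⟨hyz, h₂⟩ | ⟨hzy, h₂⟩
    · exact Or.inr (Or.inr ⟨hyx, h₁⟩)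
    · rcases lt_trichotomy x z with h | h | h
      · exact Or.inr (Or.inl ⟨h, (h₂.or hyx).resolve_left h₁⟩)
      · exact Or.inl h
      · exact absurd (h₂.mono h.le) h₁
    · exact Or.inr (Or.inr ⟨hzy.trans hyx, fun h => (h.or hzy).elim h₂ h₁⟩)

theorem ValueLe.refl (u : M) : ValueLe g u u := by
  unfold ValueLe
  by_cases h : u = 1
  · exact Or.inl h
  · by_cases h' : u = 0
    · exact Or.inr ⟨h, Or.inl h'⟩
    · exact Or.inr ⟨h, Or.inr ⟨h', lt_irrefl _⟩⟩

theorem ValueLe.trans {u v w : M} (h₁ : ValueLe g u v) (h₂ : ValueLe g v w) : ValueLe g u w := by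
  unfold ValueLe at *
  simp only [not_lt] at *
  rcases h₂ with h | ⟨hv, h⟩
  · exact Or.inl h
  · obtain ⟨hu, h'⟩ := h₁.resolve_left hv
    refine Or.inr ⟨hu, h.imp id fun ⟨hv0, h⟩ => ?_⟩
    obtain ⟨hu0, h''⟩ := h'.resolve_left hv0
    exact ⟨hu0, h''.trans h⟩

/-- The product of the order of stages and the order of values. -/
def stageValueOrder (g : M → M) : CodedRel M where
  carrier := prodSet Set.univ Set.univ
  le := {p | ∃ x, x ≤ p ∧ ∃ u, u ≤ p ∧ ∃ y, y ≤ p ∧ ∃ w, w ≤ p ∧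
    (p = pair (pair x u) (pair y w) ∧ (StageLe g x y ∧ ValueLe g u w))}

theorem stageValueOrder_le_iff {x u y w : M} :
    (stageValueOrder g).Le (pair x u) (pair y w) ↔ StageLe g x y ∧ ValueLe g u w := by
  constructor
  · rintro ⟨x', -, u', -, y', -, w', -, h, h'⟩
    obtain ⟨h₁, h₂⟩ := pair_inj.1 h
    obtain ⟨rfl, rfl⟩ := pair_inj.1 h₁
    obtain ⟨rfl, rfl⟩ := pair_inj.1 h₂
    exact h'
  · intro h
    exact ⟨x, (left_le_pair _ _).trans (left_le_pair _ _), u,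
      (right_le_pair _ _).trans (left_le_pair _ _), y, (left_le_pair _ _).trans (right_le_pair _ _),
      w, (right_le_pair _ _).trans (right_le_pair _ _), rfl, h⟩

theorem stageValueOrder_isQuasiOrder : (stageValueOrder g).IsQuasiOrder where
  carrier_mem := by
    have : (stageValueOrder g).carrier = {p | ∃ a, a ≤ p ∧ ∃ b, b ≤ p ∧ p = pair a b} := by
      ext p
      constructor
      · rintro ⟨a, -, b, -, rfl⟩
        exact ⟨a, left_le_pair _ _, b, right_le_pair _ _, rfl⟩
      · rintro ⟨a, -, b, -, rfl⟩
        exact ⟨a, trivial, b, trivial, rfl⟩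
    rw [this]
    exact setOf_mem_sets _
  le_mem := setOf_mem_sets fun p => ∃ x, x ≤ p ∧ ∃ u, u ≤ p ∧ ∃ y, y ≤ p ∧ ∃ w, w ≤ p ∧
    (p = pair (pair x u) (pair y w) ∧ (StageLe g x y ∧ ValueLe g u w))
  le_subset := by
    rintro p ⟨x, -, u, -, y, -, w, -, rfl, -⟩
    exact ⟨_, ⟨x, trivial, u, trivial, rfl⟩, _, ⟨y, trivial, w, trivial, rfl⟩, rfl⟩
  refl := by
    rintro _ ⟨x, -, u, -, rfl⟩
    exact stageValueOrder_le_iff.2 ⟨.refl x, .refl u⟩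
  trans := by
    rintro _ ⟨x, -, u, -, rfl⟩ _ ⟨y, -, v, -, rfl⟩ _ ⟨z, -, w, -, rfl⟩ h₁ h₂
    obtain ⟨h₁, h₁'⟩ := stageValueOrder_le_iff.1 h₁
    obtain ⟨h₂, h₂'⟩ := stageValueOrder_le_iff.1 h₂
    exact stageValueOrder_le_iff.2 ⟨h₁.trans h₂, h₁'.trans h₂'⟩

/-! ### Bad sequences of stages and values -/

section BadSequence

variable {F : Set M} {X U : M → M}

theorem bad_injective (hbad : ∀ i j, i < j → StageLe g (X i) (X j) → ¬ ValueLe g (U i) (U j)) :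
    Function.Injective fun i => pair (X i) (U i) := by
  intro i j h
  obtain ⟨h₁, h₂⟩ := pair_inj.1 h
  rcases lt_trichotomy i j with h' | h' | h'
  · exact absurd (h₂ ▸ ValueLe.refl _) (hbad i j h' (h₁ ▸ StageLe.refl _))
  · exact h'
  · exact absurd (h₂ ▸ ValueLe.refl _) (hbad j i h' (h₁ ▸ StageLe.refl _))

/-- In a bad sequence the stages are unbounded. -/
theorem bad_unbounded [InSets F] (hF : ∀ i x u, pair i (pair x u) ∈ F ↔ X i = x ∧ U i = u)
    (hbad : ∀ i j, i < j → StageLe g (X i) (X j) → ¬ ValueLe g (U i) (U j)) (i₀ k : M) :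
    ∃ j, i₀ < j ∧ k ≤ X j := by
  by_contra! hk
  -- Each stage below `k` that occurs after `i₀` with a value other than `0` and `1` has such an
  -- occurrence before index `b`.
  obtain ⟨b, hb⟩ := strong_bounding (fun y z => ∃ i, i ≤ z ∧ ∃ u, u ≤ z ∧
    (pair i (pair y u) ∈ F ∧ (i₀ < i ∧ (u ≠ 0 ∧ u ≠ 1)))) k
  obtain ⟨V, hV⟩ := collection (fun u v => g u = v) b fun u _ => ⟨_, rfl⟩
  obtain ⟨b', hb'⟩ := injective_unbounded g hg.injective V
  -- Past `b`, badness pushes each ordinary value under an earlier one at the same stage, so its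
  -- `g`-value is below `V`. The `+ 1` leaves room for the special value `1`.
  have key : ∀ j, i₀ < j → b ≤ j → U j ≤ b' + 1 := by
    intro j hj hbj
    by_cases h0 : U j = 0
    · simp [h0]
    by_cases h1 : U j = 1
    · simp [h1]
    obtain ⟨z, hz, i, hiz, u, huz, hi, hi₀, hu0, hu1⟩ := hb (X j) (hk j hj)
      ⟨max j (U j), j, le_max_left _ _, U j, le_max_right _ _, (hF _ _ _).2 ⟨rfl, rfl⟩, hj, h0, h1⟩
    obtain ⟨hX, hU⟩ := (hF _ _ _).1 hi
    have hlt : g (U j) < g (U i) := by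
      by_contra hc
      refine hbad i j ((hiz.trans_lt hz).trans_le hbj) (hX ▸ StageLe.refl _) ?_
      rw [← hU] at hu0 hu1
      exact Or.inr ⟨hu1, Or.inr ⟨hu0, hc⟩⟩
    obtain ⟨v, hv, hgv⟩ := hV (U i) (hU ▸ huz.trans_lt hz)
    by_contra! hc
    exact absurd (hlt.trans (hgv ▸ hv)) (not_lt.2 (hb' _ ((lt_add_one b').trans hc).le))
  have hgraph : Sigma0 fun e : ℕ → M =>
      (fun i => pair (X (i + (i₀ + b + 1))) (U (i + (i₀ + b + 1)))) (e 0) = e 1 := by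
    refine Sigma0.congr (P := fun e => ∃ x, x ≤ e 1 ∧ ∃ u, u ≤ e 1 ∧
      (e 1 = pair x u ∧ pair (e 0 + (i₀ + b + 1)) (pair x u) ∈ F)) (by infer_instance) fun e => ?_
    constructor
    · intro h
      simp only at h
      rw [← h]
      exact ⟨_, left_le_pair _ _, _, right_le_pair _ _, rfl, (hF _ _ _).2 ⟨rfl, rfl⟩⟩
    · rintro ⟨x, -, u, -, h, hxu⟩
      obtain ⟨rfl, rfl⟩ := (hF _ _ _).1 hxu
      exact h.symm
  -- The tail beyond `i₀` and `b` would be an injection into the pairs bounded by `k` and `b' + 1`.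
  obtain ⟨c, hc⟩ := injective_unbounded
    (fun i => pair (X (i + (i₀ + b + 1))) (U (i + (i₀ + b + 1))))
    (fun i j h => add_right_cancel (bad_injective hbad h)) (pair k (b' + 1) + 1)
  have hc' := hc c le_rfl
  have h1 : i₀ < c + (i₀ + b + 1) :=
    (le_add_left le_self_add : i₀ ≤ c + (i₀ + b)).trans_lt
      ((lt_add_one (c + (i₀ + b))).trans_eq (add_assoc _ _ _))
  have h2 : b ≤ c + (i₀ + b + 1) := le_add_left (le_add_right le_add_self)
  exact absurd (hc'.trans (pair_mono (hk _ h1).le (key _ h1 h2))) (not_le.2 (lt_add_one _))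

/-- From some point on, all late stages that occur in a bad sequence are true. -/
theorem bad_eventually_true [InSets F]
    (hF : ∀ i x u, pair i (pair x u) ∈ F ↔ X i = x ∧ U i = u)
    (hbad : ∀ i j, i < j → StageLe g (X i) (X j) → ¬ ValueLe g (U i) (U j)) :
    ∃ i₀ k₀, ∀ j, i₀ < j → k₀ ≤ X j → ∀ k, X j < k → g (X j) ≤ g k := by
  by_cases hex : ∃ i k, X i < k ∧ g k < g (X i)
  swap
  · push Not at hex
    exact ⟨0, 0, fun j _ _ k hk => hex j k hk⟩
  -- Among the terms with a false stage, one has a least value: minimise `g` over the ordinary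
  -- values if there are any, otherwise take `0`, otherwise `1`. Being false is `Σ⁰₁`, so the `Σ⁰₁`
  -- least number principle suffices.
  obtain ⟨i, k, hik, hgk, hmin⟩ : ∃ i k, X i < k ∧ g k < g (X i) ∧
      ∀ j l, X j < l → g l < g (X j) → ValueLe g (U i) (U j) := by
    by_cases h1 : ∃ i k, X i < k ∧ g k < g (X i) ∧ U i ≠ 0 ∧ U i ≠ 1
    · obtain ⟨i, k, hik, hgk, h0, h1⟩ := h1
      have hwit : ∀ i k, X i < k → g k < g (X i) → U i ≠ 0 → U i ≠ 1 →
          ∃ z, ∃ i', i' ≤ z ∧ ∃ x, x ≤ z ∧ ∃ u, u ≤ z ∧ ∃ k', k' ≤ z ∧ (pair i' (pair x u) ∈ F ∧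
            (x < k' ∧ (g k' < g x ∧ (u ≠ 0 ∧ (u ≠ 1 ∧ g u = g (U i)))))) := fun i k hik hgk h0 h1 =>
        ⟨i + (X i + (U i + k)), i, le_self_add, X i, le_add_left le_self_add, U i,
          le_add_left (le_add_left le_self_add), k, le_add_left (le_add_left le_add_self),
          (hF _ _ _).2 ⟨rfl, rfl⟩, hik, hgk, h0, h1, rfl⟩
      obtain ⟨n, ⟨z, i, -, x, -, u, -, k, -, hi, hxk, hgk, h0, h1, hn⟩, hmin⟩ := exists_least
        (fun n z => ∃ i, i ≤ z ∧ ∃ x, x ≤ z ∧ ∃ u, u ≤ z ∧ ∃ k, k ≤ z ∧ (pair i (pair x u) ∈ F ∧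
          (x < k ∧ (g k < g x ∧ (u ≠ 0 ∧ (u ≠ 1 ∧ g u = n))))))
        ⟨g (U i), hwit i k hik hgk h0 h1⟩
      obtain ⟨rfl, rfl⟩ := (hF _ _ _).1 hi
      refine ⟨i, k, hxk, hgk, fun j l hl hgl => ?_⟩
      by_cases hj1 : U j = 1
      · exact Or.inl hj1
      by_cases hj0 : U j = 0
      · exact Or.inr ⟨h1, Or.inl hj0⟩
      exact Or.inr ⟨h1, Or.inr ⟨h0, fun h => hmin _ (hn ▸ h) (hwit j l hl hgl hj0 hj1)⟩⟩
    · push Not at h1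
      by_cases h2 : ∃ i k, X i < k ∧ g k < g (X i) ∧ U i = 0
      · obtain ⟨i, k, hik, hgk, h0⟩ := h2
        refine ⟨i, k, hik, hgk, fun j l hl hgl => ?_⟩
        by_cases hj0 : U j = 0
        · exact Or.inr ⟨by simp [h0], Or.inl hj0⟩
        · exact Or.inl (h1 j l hl hgl hj0)
      · push Not at h2
        obtain ⟨i, k, hik, hgk⟩ := hex
        exact ⟨i, k, hik, hgk, fun j l hl hgl => Or.inl (h1 j l hl hgl (h2 j l hl hgl))⟩
  refine ⟨i, k, fun j hj hkj l hl => ?_⟩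
  by_contra! hc
  -- The witness `k` against `X i` is at most `X j`, so `X i` precedes `X j`; were `X j` false too,
  -- minimality of `U i` would contradict badness.
  exact hbad i j hj (Or.inr (Or.inl ⟨hik.trans_le hkj, k, hkj, hik, hgk⟩)) (hmin j l hl hc)

/-- A bad sequence computes the range of the enumeration. -/
theorem range_mem_sets_of_bad [InSets F]
    (hF : ∀ i x u, pair i (pair x u) ∈ F ↔ X i = x ∧ U i = u)
    (hbad : ∀ i j, i < j → StageLe g (X i) (X j) → ¬ ValueLe g (U i) (U j)) :
    {n | ∃ x, g x = n} ∈ L2Structure.sets := by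
  obtain ⟨i₀, k₀, h⟩ := bad_eventually_true hF hbad
  have hgraph : Sigma0 fun e : ℕ → M => g (e 1) = e 0 := inferInstance
  -- The complement of the range is `Σ⁰₁` too: `n` is missing exactly if some true stage `x = X j`
  -- has `n < g x` and `n` is not enumerated up to `x`. The variable `z` bounds all witnesses at
  -- once.
  refine delta_comprehension (fun n x => g x = n) (fun n z => ¬ ∃ j, j ≤ z ∧ ∃ x, x ≤ z ∧
    ∃ u, u ≤ z ∧ ∃ v, v ≤ z ∧ (pair j (pair x u) ∈ F ∧ (i₀ < j ∧ (k₀ ≤ x ∧ (g x = v ∧ (n < v ∧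
      ∀ y, y ≤ x → ¬ g y = n)))))) fun n => ?_
  constructor
  · rintro ⟨y, rfl⟩ z ⟨j, -, x, -, u, -, v, -, hj, hij, hkx, rfl, hv, hy⟩
    obtain ⟨rfl, rfl⟩ := (hF _ _ _).1 hj
    have : X j < y := not_le.1 fun h => hy y h rfl
    exact absurd (h j hij hkx y this) (not_le.2 hv)
  · intro hn
    by_contra! hc
    obtain ⟨b, hb⟩ := injective_unbounded g hg.injective (n + 1)
    obtain ⟨j, hj, hbj⟩ := bad_unbounded hF hbad i₀ (max k₀ b)
    refine hn (j + (X j + (U j + g (X j)))) ⟨j, le_self_add, X j, le_add_left le_self_add, U j,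
      le_add_left (le_add_left le_self_add), g (X j), le_add_left (le_add_left le_add_self),
      (hF _ _ _).2 ⟨rfl, rfl⟩, hj, (le_max_left _ _).trans hbj, rfl, ?_, fun y _ => hc y⟩
    exact add_one_le_iff.1 (hb _ ((le_max_right _ _).trans hbj))

end BadSequence

theorem stageValueOrder_isWqo (hrange : {n | ∃ x, g x = n} ∉ L2Structure.sets) :
    (stageValueOrder g).IsWqo := by
  refine ⟨stageValueOrder_isQuasiOrder, fun F hF => ?_⟩
  by_contra! hbad
  have hex : ∀ i, ∃ x u, pair i (pair x u) ∈ F := by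
    intro i
    obtain ⟨b, hb, -⟩ := hF.2.2 i trivial
    obtain ⟨_, -, _, ⟨x, -, u, -, rfl⟩, h⟩ := hF.2.1 hb
    exact ⟨x, u, (pair_inj.1 h).2 ▸ hb⟩
  choose X U hXU using hex
  have hF' : ∀ i x u, pair i (pair x u) ∈ F ↔ X i = x ∧ U i = u := by
    intro i x u
    constructor
    · exact fun h => pair_inj.1 ((hF.2.2 i trivial).unique (hXU i) h)
    · rintro ⟨rfl, rfl⟩
      exact hXU i
  have : InSets F := ⟨hF.1⟩
  refine hrange (range_mem_sets_of_bad hF' fun i j hij h₁ h₂ => ?_)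
  exact hbad i j _ _ hij (hXU i) (hXU j) (stageValueOrder_le_iff.2 ⟨h₁, h₂⟩)

end

/-! ### Parity -/

theorem even_or_odd (x : M) : ∃ r, x = r + r ∨ x = r + r + 1 := by
  obtain ⟨r, -, hr⟩ := induction_on (fun x : M => ∃ r, r ≤ x ∧ (x = r + r ∨ x = r + r + 1))
    ⟨0, le_rfl, Or.inl (add_zero 0).symm⟩ (by
      rintro n ⟨r, hr, rfl | rfl⟩
      · exact ⟨r, hr.trans le_self_add, Or.inr rfl⟩
      · exact ⟨r + 1, add_le_add hr le_rfl, Or.inl (by ring)⟩) x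
  exact ⟨r, hr⟩

theorem double_lt_double {a b : M} : a + a < b + b ↔ a < b := by
  constructor
  · intro h
    by_contra! hc
    exact absurd h (not_lt.2 (add_le_add hc hc))
  · exact fun h => add_lt_add h h

theorem double_inj {a b : M} : a + a = b + b ↔ a = b := by
  constructor
  · intro h
    rcases lt_trichotomy a b with h' | h' | h'
    · exact absurd h (double_lt_double.2 h').ne
    · exact h'
    · exact absurd h (double_lt_double.2 h').ne'
  · rintro rfl
    rfl

theorem double_add_one_lt_double {a b : M} : a + a + 1 < b + b ↔ a < b := by
  constructor
  · exact fun h => double_lt_double.1 ((lt_add_one _).trans h)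
  · intro h
    have h1 : a + 1 ≤ b := add_one_le_iff.2 h
    have h2 : a + a + 1 + 1 = (a + 1) + (a + 1) := by ring
    exact lt_of_lt_of_le (lt_add_one _) (h2.trans_le (add_le_add h1 h1))

theorem double_add_one_ne_double (a b : M) : a + a + 1 ≠ b + b := by
  intro h
  rcases lt_or_ge a b with h' | h'
  · exact (double_add_one_lt_double.2 h').ne h
  · exact absurd (add_le_add h' h') (not_le.2 (h ▸ lt_add_one (a + a)))

theorem double_eq_zero {a : M} : a + a = 0 ↔ a = 0 := by
  simp

theorem double_ne_one (a : M) : a + a ≠ 1 := by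
  have := (double_add_one_ne_double 0 a).symm
  simpa using this

/-! ### A strictly descending sequence of closed sets -/

section

variable (g : M → M) [hg : PairedEnumeration g]

/-- Indices `s, r` of an element of the `n`-th finite set of the bad sequence: `s` is paired with
the next stage of least value up to `n`, or with `0` if `s` is the last stage. -/
def NextStage (n s r : M) : Prop :=
  (s = n ∧ r = 0) ∨ (s < r ∧ (r ≤ n ∧ ∀ k, k ≤ n → s < k → ¬ g (k + k) < g (r + r)))

/-- `z` is the code of a finite set that generates the complement of the up-closure of the pair of
`2 s` and `2 r + 1`. -/
def CodesComplement (z s r : M) : Prop :=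
  IsFinCode z ∧ (FinMem (pair (s + s + 1) 1) z ∧ (FinMem (pair 0 (r + r)) z ∧
    ∀ i, i < z → FinMem i z → i = pair (s + s + 1) 1 ∨ i = pair 0 (r + r)))

/-- `z` codes the complement for one of the elements of the `n`-th finite set. -/
def IsComplement (n z : M) : Prop :=
  ∃ s, s ≤ n ∧ ∃ r, r ≤ n ∧ (NextStage g n s r ∧ CodesComplement z s r)

/-- `c` is the code of the set of all `z` with `IsComplement g n z`. -/
def CodesComplements (n c : M) : Prop :=
  IsFinCode c ∧ ((∀ z, z < c → FinMem z c → IsComplement g n z) ∧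
    ∀ s, s ≤ n → ∀ r, r ≤ n → NextStage g n s r → ∃ z, z < c ∧ (FinMem z c ∧ CodesComplement z s r))

/-- `c` is the value at `(n, m)` of the function that codes the descending sequence. -/
def IsClosedCode (n m c : M) : Prop :=
  IsFinCode c ∧ ∃ d, d < c ∧ (FinMem d c ∧ ((∀ i, i < c → FinMem i c → i = d) ∧
    ((m ≤ n ∧ CodesComplements g m d) ∨ (n < m ∧ CodesComplements g n d))))

instance Sigma0.nextStage {n s r : (ℕ → M) → M} [TermDef n] [TermDef s] [TermDef r] :
    Sigma0 fun e => NextStage g (n e) (s e) (r e) := by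
  refine Sigma0.comp₃ (P := NextStage g) ?_ n s r
  unfold NextStage
  infer_instance

instance Sigma0.codesComplement {z s r : (ℕ → M) → M} [TermDef z] [TermDef s] [TermDef r] :
    Sigma0 fun e => CodesComplement (z e) (s e) (r e) := by
  refine Sigma0.comp₃ (P := CodesComplement) ?_ z s r
  unfold CodesComplement
  infer_instance

instance Sigma0.isComplement {n z : (ℕ → M) → M} [TermDef n] [TermDef z] :
    Sigma0 fun e => IsComplement g (n e) (z e) := by
  refine Sigma0.comp₂ (P := IsComplement g) ?_ n z
  unfold IsComplement
  infer_instance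

instance Sigma0.codesComplements {n c : (ℕ → M) → M} [TermDef n] [TermDef c] :
    Sigma0 fun e => CodesComplements g (n e) (c e) := by
  refine Sigma0.comp₂ (P := CodesComplements g) ?_ n c
  unfold CodesComplements
  infer_instance

instance Sigma0.isClosedCode {n m c : (ℕ → M) → M} [TermDef n] [TermDef m] [TermDef c] :
    Sigma0 fun e => IsClosedCode g (n e) (m e) (c e) := by
  refine Sigma0.comp₃ (P := IsClosedCode g) ?_ n m c
  unfold IsClosedCode
  infer_instance

/-- The graph of the function that codes the descending sequence. -/
def closedCodes : Set M :=
  {p | ∃ n, n ≤ p ∧ ∃ m, m ≤ p ∧ ∃ c, c ≤ p ∧ (p = pair (pair n m) c ∧ IsClosedCode g n m c)}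

variable {g}

theorem CodesComplement.finMem_iff {z s r i : M} (h : CodesComplement z s r) :
    FinMem i z ↔ i = pair (s + s + 1) 1 ∨ i = pair 0 (r + r) := by
  constructor
  · exact fun hi => h.2.2.2 i hi.lt hi
  · rintro (rfl | rfl)
    exacts [h.2.1, h.2.2.1]

theorem exists_codesComplement (s r : M) : ∃ z, CodesComplement z s r := by
  obtain ⟨z, hz, hz'⟩ := exists_codes (fun i => i = pair (s + s + 1) 1 ∨ i = pair 0 (r + r))
    (pair (s + s + 1) 1 + pair 0 (r + r) + 1) (by
      rintro i (rfl | rfl)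
      · exact lt_add_one_iff.2 le_self_add
      · exact lt_add_one_iff.2 le_add_self)
  exact ⟨z, hz, (hz' _).2 (Or.inl rfl), (hz' _).2 (Or.inr rfl), fun i _ hi => (hz' i).1 hi⟩

theorem CodesComplement.unique {z z' s r : M} (h : CodesComplement z s r)
    (h' : CodesComplement z' s r) : z = z' :=
  Codes.unique (X := {i | i = pair (s + s + 1) 1 ∨ i = pair 0 (r + r)})
    ⟨h.1, fun _ => h.finMem_iff⟩ ⟨h'.1, fun _ => h'.finMem_iff⟩

theorem NextStage.le {n s r : M} (h : NextStage g n s r) : s ≤ n ∧ r ≤ n := by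
  rcases h with ⟨rfl, rfl⟩ | ⟨h₁, h₂, -⟩
  · exact ⟨le_rfl, zero_le⟩
  · exact ⟨h₁.le.trans h₂, h₂⟩

theorem CodesComplements.finMem_iff {n c z : M} (h : CodesComplements g n c) :
    FinMem z c ↔ IsComplement g n z := by
  constructor
  · exact fun hz => h.2.1 z hz.lt hz
  · rintro ⟨s, hs, r, hr, h₁, h₂⟩
    obtain ⟨z', -, hz', h₃⟩ := h.2.2 s hs r hr h₁
    rwa [h₂.unique h₃]

theorem exists_codesComplements (n : M) : ∃ c, CodesComplements g n c := by
  -- Collection runs over all codes `y` up to `pair n n`; where `y` is not a pair the condition is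
  -- vacuous and `0` serves as a dummy. The resulting bound is what makes the set of complements
  -- codable.
  obtain ⟨b, hb⟩ := collection (fun y z => ∀ s, s ≤ y → ∀ r, r ≤ y → y = pair s r →
    CodesComplement z s r) (pair n n + 1) (by
      intro y _
      by_cases hy : ∃ s r, y = pair s r
      · obtain ⟨s, r, rfl⟩ := hy
        obtain ⟨z, hz⟩ := exists_codesComplement s r
        refine ⟨z, fun s' _ r' _ h => ?_⟩
        obtain ⟨rfl, rfl⟩ := pair_inj.1 h
        exact hz
      · exact ⟨0, fun s _ r _ h => absurd ⟨s, r, h⟩ hy⟩)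
  have hlt : ∀ s r z, s ≤ n → r ≤ n → CodesComplement z s r → z < b := by
    intro s r z hs hr hz
    obtain ⟨z', hz', h⟩ := hb (pair s r) (lt_add_one_iff.2 (pair_mono hs hr))
    rw [hz.unique (h s (left_le_pair _ _) r (right_le_pair _ _) rfl)]
    exact hz'
  obtain ⟨c, hc, hc'⟩ := exists_codes (fun z => IsComplement g n z) b (by
    rintro z ⟨s, hs, r, hr, -, hz⟩
    exact hlt s r z hs hr hz)
  refine ⟨c, hc, fun z _ hz => (hc' z).1 hz, fun s hs r hr h => ?_⟩
  obtain ⟨z, hz⟩ := exists_codesComplement s r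
  have hzc : FinMem z c := (hc' z).2 ⟨s, hs, r, hr, h, hz⟩
  exact ⟨z, hzc.lt, hzc, hz⟩

theorem CodesComplements.unique {n c d : M} (hc : CodesComplements g n c)
    (hd : CodesComplements g n d) : c = d :=
  Codes.unique (X := {z | IsComplement g n z}) ⟨hc.1, fun _ => hc.finMem_iff⟩
    ⟨hd.1, fun _ => hd.finMem_iff⟩

theorem CodesComplement.mem_finSubsets {z s r : M} (h : CodesComplement z s r) :
    z ∈ finSubsets (stageValueOrder g).carrier := by
  refine ⟨h.1, fun i hi => ?_⟩
  rcases h.finMem_iff.1 hi with rfl | rfl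
  · exact ⟨_, trivial, _, trivial, rfl⟩
  · exact ⟨_, trivial, _, trivial, rfl⟩

theorem CodesComplements.mem_finSubsets {n c : M} (h : CodesComplements g n c) :
    c ∈ finSubsets (stageValueOrder g).finFlat.carrier := by
  refine ⟨h.1, fun z hz => ?_⟩
  obtain ⟨s, -, r, -, -, h⟩ := h.finMem_iff.1 hz
  exact h.mem_finSubsets

/-- The value at `(n, m)` is a singleton belonging to the index `min m n`. The `n`-th closed set
thus imposes only the constraints with index at most `n`, and the sequence descends. -/
theorem IsClosedCode.exists_codesComplements {n m c : M} (h : IsClosedCode g n m c) :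
    ∃ m' d, m' ≤ n ∧ (m ≤ n → m' = m) ∧ CodesComplements g m' d ∧ ∀ i, FinMem i c ↔ i = d := by
  obtain ⟨hc, d, hd, hdc, hi, h⟩ := h
  have hi' : ∀ i, FinMem i c ↔ i = d := fun i => ⟨fun h => hi i h.lt h, fun h => h ▸ hdc⟩
  rcases h with ⟨hm, h⟩ | ⟨hm, h⟩
  · exact ⟨m, d, hm, fun _ => rfl, h, hi'⟩
  · exact ⟨n, d, le_rfl, fun h => absurd h (not_le.2 hm), h, hi'⟩

theorem IsClosedCode.mem_finSubsets {n m c : M} (h : IsClosedCode g n m c) :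
    c ∈ finSubsets (stageValueOrder g).finFlat.upper.index := by
  refine ⟨h.1, fun i hi => ?_⟩
  obtain ⟨m', d, -, -, hd, hid⟩ := h.exists_codesComplements
  rw [(hid i).1 hi]
  exact hd.mem_finSubsets

theorem exists_isClosedCode (n m : M) : ∃ c, IsClosedCode g n m c := by
  have hsingle : ∀ d : M, ∃ c, IsFinCode c ∧ ∀ i, FinMem i c ↔ i = d := fun d => by
    obtain ⟨c, hc, hc'⟩ := exists_codes (fun i => i = d) (d + 1) (by
      rintro i rfl
      exact lt_add_one i)
    exact ⟨c, hc, hc'⟩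
  rcases le_or_gt m n with h | h
  · obtain ⟨d, hd⟩ := exists_codesComplements (g := g) m
    obtain ⟨c, hc, hc'⟩ := hsingle d
    have hdc : FinMem d c := (hc' d).2 rfl
    exact ⟨c, hc, d, hdc.lt, hdc, fun i _ => (hc' i).1, Or.inl ⟨h, hd⟩⟩
  · obtain ⟨d, hd⟩ := exists_codesComplements (g := g) n
    obtain ⟨c, hc, hc'⟩ := hsingle d
    have hdc : FinMem d c := (hc' d).2 rfl
    exact ⟨c, hc, d, hdc.lt, hdc, fun i _ => (hc' i).1, Or.inr ⟨h, hd⟩⟩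

theorem IsClosedCode.unique {n m c c' : M} (h : IsClosedCode g n m c) (h' : IsClosedCode g n m c') :
    c = c' := by
  obtain ⟨hc, d, -, hdc, hi, h⟩ := h
  obtain ⟨hc', d', -, hdc', hi', h'⟩ := h'
  have hd : d = d' := by
    rcases h with ⟨hm, h⟩ | ⟨hm, h⟩ <;> rcases h' with ⟨hm', h'⟩ | ⟨hm', h'⟩
    · exact h.unique h'
    · exact absurd hm (not_le.2 hm')
    · exact absurd hm' (not_le.2 hm)
    · exact h.unique h'
  subst hd
  exact Codes.unique (X := {d}) ⟨hc, fun i => ⟨fun h => hi i h.lt h, fun h => h ▸ hdc⟩⟩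
    ⟨hc', fun i => ⟨fun h => hi' i h.lt h, fun h => h ▸ hdc'⟩⟩

theorem pair_mem_closedCodes {n m c : M} :
    pair (pair n m) c ∈ closedCodes g ↔ IsClosedCode g n m c := by
  constructor
  · rintro ⟨n', -, m', -, c', -, h, h'⟩
    obtain ⟨h₁, rfl⟩ := pair_inj.1 h
    obtain ⟨rfl, rfl⟩ := pair_inj.1 h₁
    exact h'
  · exact fun h => ⟨n, (left_le_pair _ _).trans (left_le_pair _ _), m,
      (right_le_pair _ _).trans (left_le_pair _ _), c, right_le_pair _ _, rfl, h⟩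

theorem closedCodes_isFunction : IsFunction (closedCodes g) (prodSet Set.univ Set.univ)
    (finSubsets (stageValueOrder g).finFlat.upper.index) := by
  refine ⟨setOf_mem_sets fun p => ∃ n, n ≤ p ∧ ∃ m, m ≤ p ∧ ∃ c, c ≤ p ∧
    (p = pair (pair n m) c ∧ IsClosedCode g n m c), ?_, ?_⟩
  · rintro p ⟨n, -, m, -, c, -, rfl, h⟩
    exact ⟨_, ⟨n, trivial, m, trivial, rfl⟩, c, h.mem_finSubsets, rfl⟩
  · rintro _ ⟨n, -, m, -, rfl⟩
    obtain ⟨c, hc⟩ := exists_isClosedCode (g := g) n m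
    exact ⟨c, pair_mem_closedCodes.2 hc, fun c' hc' => (pair_mem_closedCodes.1 hc').unique hc⟩

theorem finFlat_le_iff {x z s r : M} (hx : x ∈ finSubsets (stageValueOrder g).carrier)
    (hz : CodesComplement z s r) :
    (stageValueOrder g).finFlat.Le x z ↔ ∀ p, FinMem p x →
      (stageValueOrder g).Le p (pair (s + s + 1) 1) ∨
        (stageValueOrder g).Le p (pair 0 (r + r)) := by
  constructor
  · rintro ⟨a, -, b, -, hab, h⟩ p hp
    obtain ⟨rfl, rfl⟩ := pair_inj.1 hab
    obtain ⟨j, hj, hpj⟩ := h p hp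
    rcases hz.finMem_iff.1 hj with rfl | rfl
    exacts [Or.inl hpj, Or.inr hpj]
  · intro h
    refine ⟨x, hx, z, hz.mem_finSubsets, rfl, fun p hp => ?_⟩
    rcases h p hp with h | h
    · exact ⟨_, hz.2.1, h⟩
    · exact ⟨_, hz.2.2.1, h⟩

/-- A point avoids the basic open set `U_d` exactly if it is `≤♭` one of the finite sets listed in
`d`. Each listed set has two elements, one bounding stages and one bounding values. -/
theorem mem_closedTerm_iff {n x : M} :
    x ∈ (stageValueOrder g).finFlat.upper.closedTerm (closedCodes g) n ↔
      x ∈ finSubsets (stageValueOrder g).carrier ∧ ∀ m, m ≤ n → ∃ s r, NextStage g m s r ∧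
        ∀ p, FinMem p x → (stageValueOrder g).Le p (pair (s + s + 1) 1) ∨
          (stageValueOrder g).Le p (pair 0 (r + r)) := by
  constructor
  · rintro ⟨hx, h⟩
    refine ⟨hx, fun m hm => ?_⟩
    obtain ⟨c, hc⟩ := exists_isClosedCode (g := g) n m
    obtain ⟨m', d, -, hmm, hd, hi⟩ := hc.exists_codesComplements
    obtain rfl := hmm hm
    have h' := h m' c d (pair_mem_closedCodes.2 hc) ((hi d).2 rfl)
    have h'' : ∃ z, FinMem z d ∧ (stageValueOrder g).finFlat.Le x z := by
      by_contra hcon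
      exact h' ⟨hx, hcon⟩
    obtain ⟨z, hz, hxz⟩ := h''
    obtain ⟨s, -, r, -, hsr, hz⟩ := hd.finMem_iff.1 hz
    exact ⟨s, r, hsr, (finFlat_le_iff hx hz).1 hxz⟩
  · rintro ⟨hx, h⟩
    refine ⟨hx, fun m c i hc hi => ?_⟩
    obtain ⟨m', d, hm', -, hd, hid⟩ := (pair_mem_closedCodes.1 hc).exists_codesComplements
    rw [(hid i).1 hi]
    rintro ⟨-, hcon⟩
    obtain ⟨s, r, hsr, hp⟩ := h m' hm'
    obtain ⟨z, hz⟩ := exists_codesComplement s r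
    exact hcon ⟨z, hd.finMem_iff.2 ⟨s, hsr.le.1, r, hsr.le.2, hsr, hz⟩, (finFlat_le_iff hx hz).2 hp⟩

/-! The bad sequence of finite sets -/

theorem exists_nextStage_code (n : M) :
    ∃ x, IsFinCode x ∧ ∀ p, FinMem p x ↔
      ∃ s r, NextStage g n s r ∧ p = pair (s + s) (r + r + 1) := by
  obtain ⟨x, hx, hx'⟩ := exists_codes (fun p => ∃ s, s ≤ n ∧ ∃ r, r ≤ n ∧
    (NextStage g n s r ∧ p = pair (s + s) (r + r + 1))) (pair (n + n) (n + n + 1) + 1) (by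
      rintro p ⟨s, hs, r, hr, -, rfl⟩
      exact lt_add_one_iff.2 (pair_mono (add_le_add hs hs) (add_le_add (add_le_add hr hr) le_rfl)))
  refine ⟨x, hx, fun p => (hx' p).trans ?_⟩
  constructor
  · rintro ⟨s, -, r, -, h, rfl⟩
    exact ⟨s, r, h, rfl⟩
  · rintro ⟨s, r, h, rfl⟩
    exact ⟨s, h.le.1, r, h.le.2, h, rfl⟩

/-! ### Predecessors and bounds for stages and values -/

theorem exists_argmin {a b : M} (hab : a < b) :
    ∃ k, a < k ∧ k ≤ b ∧ ∀ j, a < j → j ≤ b → ¬ g (j + j) < g (k + k) := by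
  have hgraph : Sigma0 fun e : ℕ → M => ∃ k, k ≤ b ∧ (a < k ∧ g (k + k) = e 0) := inferInstance
  obtain ⟨v, ⟨k, hk, hak, rfl⟩, hv⟩ := exists_least' (fun v => ∃ k, k ≤ b ∧ (a < k ∧ g (k + k) = v))
    ⟨_, b, le_rfl, hab, rfl⟩
  exact ⟨k, hak, hk, fun j hj hj' h => hv _ h ⟨j, hj', hj, rfl⟩⟩

theorem pos_of_pos {k : M} (hk : 0 < k) : 0 < g k := by
  rw [pos_iff_ne_zero, ← hg.map_zero]
  exact fun h => hk.ne' (hg.injective h)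

/-- Nothing is smaller than `g 0 = 0`, so stage `0` is never seen to be false. -/
theorem stageLe_zero (x : M) : StageLe g x 0 := by
  rcases eq_or_ne x 0 with rfl | hx
  · exact .refl _
  · refine Or.inr (Or.inr ⟨pos_iff_ne_zero.2 hx, ?_⟩)
    rintro ⟨k, -, -, hk⟩
    rw [hg.map_zero] at hk
    exact absurd hk (not_lt.2 zero_le)

/-- A stage that falsifies `2s + 1` has value at most `g (2s)`. Even stages up to `2t` are excluded
by the hypothesis, and an odd stage only exceeds its even neighbour. -/
theorem stageLe_double_add_one {s t : M} (hst : s < t)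
    (h : ∀ k, s < k → k ≤ t → g (s + s) < g (k + k)) : StageLe g (t + t) (s + s + 1) := by
  refine Or.inr (Or.inr ⟨double_add_one_lt_double.2 hst, ?_⟩)
  rintro ⟨k, hk, hsk, hgk⟩
  rw [hg.map_odd, lt_add_one_iff] at hgk
  obtain ⟨j, rfl | rfl⟩ := even_or_odd k
  · have h1 : s < j := double_add_one_lt_double.1 hsk
    have h2 : j ≤ t := by
      by_contra! hc
      exact absurd hk (not_le.2 (double_lt_double.2 hc))
    exact absurd (h j h1 h2) (not_lt.2 hgk)
  · have h1 : s < j := double_lt_double.1 ((add_lt_add_iff_right 1).1 hsk)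
    have h2 : j ≤ t := by
      by_contra! hc
      exact absurd ((lt_add_one _).trans_le hk) (not_lt.2 (add_le_add hc.le hc.le))
    rw [hg.map_odd] at hgk
    exact absurd ((h j h1 h2).trans (lt_add_one _)) (not_lt.2 hgk)

/-- The only stage that could falsify `2s` by stage `2s + 1` is `2s + 1` itself, whose value is
larger. -/
theorem not_stageLe_succ (s : M) : ¬ StageLe g (s + s) (s + s + 1) := by
  rintro (h | ⟨-, k, hk, hsk, hgk⟩ | ⟨h, -⟩)
  · exact (lt_add_one _).ne h
  · have : k = s + s + 1 := le_antisymm hk (add_one_le_iff.2 hsk)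
    rw [this, hg.map_odd] at hgk
    exact absurd hgk (not_lt.2 (lt_add_one _).le)
  · exact absurd h (not_lt.2 (lt_add_one _).le)

/-- For `r = 0` this compares the two added elements, `1` lying strictly above `0`; otherwise `g (2r
+ 1) = g (2r) + 1` decides. -/
theorem not_valueLe_pred (r : M) : ¬ ValueLe g (r + r + 1) (r + r) := by
  rintro (h | ⟨h1, h | ⟨-, h⟩⟩)
  · exact double_ne_one r h
  · rw [double_eq_zero] at h
    rw [h] at h1
    simp at h1
  · rw [hg.map_odd] at h
    exact h (lt_add_one _)

theorem double_add_one_ne_one {r : M} (hr : 0 < r) : r + r + 1 ≠ 1 := by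
  intro h
  have : r + r = 0 := by simpa using h
  exact hr.ne' (double_eq_zero.1 this)

/-- Later sets of the sequence lie in the complement of the up-closure of an earlier one. -/
theorem exists_nextStage_bound {n m : M} (hnm : n < m) :
    ∃ s r, NextStage g n s r ∧ ∀ s' r', NextStage g m s' r' →
      StageLe g (s' + s') (s + s + 1) ∨ ValueLe g (r' + r' + 1) (r + r) := by
  obtain ⟨k, hnk, hkm, hk⟩ := exists_argmin (g := g) hnm
  rcases lt_or_ge (g (n + n)) (g (k + k)) with hgk | hgk
  · refine ⟨n, 0, Or.inl ⟨rfl, rfl⟩, fun s' r' h' => ?_⟩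
    rcases lt_or_ge n s' with hs | hs
    · exact Or.inl (stageLe_double_add_one hs fun j hj hj' =>
        hgk.trans_le (not_lt.1 (hk j hj (hj'.trans h'.le.1))))
    · rcases h' with ⟨rfl, -⟩ | ⟨hsr, -⟩
      · exact absurd hnm (not_lt.2 hs)
      · exact Or.inr (Or.inr ⟨double_add_one_ne_one (zero_le.trans_lt hsr), Or.inl (add_zero 0)⟩)
  · have hgkn : g (k + k) < g (n + n) := by
      refine lt_of_le_of_ne hgk fun h => hnk.ne' (double_inj.1 (hg.injective h))
    have hk0 : 0 < k := zero_le.trans_lt hnk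
    -- Here `s` is the last index up to `n` that the new minimum `g (2k)` does not undercut; index
    -- `0` qualifies since `g 0 = 0`. The partner `r` of `s` is undercut, by maximality of `s`.
    obtain ⟨s, hsn, hsk, hs⟩ := exists_greatest (fun s => g (s + s) < g (k + k)) n
      ⟨0, zero_le, by
        rw [add_zero, hg.map_zero]
        exact pos_of_pos (add_pos hk0 hk0)⟩
    have hsn' : s < n := lt_of_le_of_ne hsn fun h => absurd hsk (not_lt.2 (h ▸ hgkn.le))
    obtain ⟨r, hsr, hrn, hr⟩ := exists_argmin (g := g) hsn'
    have hkr : g (k + k) < g (r + r) := by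
      refine lt_of_le_of_ne (not_lt.1 fun h => absurd (hs r hrn h) (not_le.2 hsr)) fun h => ?_
      exact absurd (double_inj.1 (hg.injective h)) (hrn.trans_lt hnk).ne'
    refine ⟨s, r, Or.inr ⟨hsr, hrn, fun j hj hj' => hr j hj' hj⟩, fun s' r' h' => ?_⟩
    rcases lt_or_ge s s' with hss | hss
    · refine Or.inl (stageLe_double_add_one hss fun j hj hj' => ?_)
      rcases le_or_gt j n with hjn | hjn
      · exact hsk.trans_le (hkr.le.trans (not_lt.1 (hr j hj hjn)))
      · exact hsk.trans_le (not_lt.1 (hk j hjn (hj'.trans h'.le.1)))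
    · rcases h' with ⟨rfl, -⟩ | ⟨hsr', hrm, hr'⟩
      · exact absurd (hnm.trans_le (hss.trans hsn)) (lt_irrefl _)
      · refine Or.inr (Or.inr ⟨double_add_one_ne_one (zero_le.trans_lt hsr'), Or.inr ⟨?_, ?_⟩⟩)
        · exact (zero_le.trans_lt (lt_add_one (r' + r'))).ne'
        · rw [hg.map_odd, not_lt, add_one_le_iff]
          exact (not_lt.1 (hr' k hkm ((hss.trans hsn).trans_lt hnk))).trans_lt hkr

/-- The upper topology of the finite subsets is not Noetherian. -/
theorem not_isNoetherian : ¬ (stageValueOrder g).finFlat.upper.IsNoetherian := by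
  intro h
  obtain ⟨N, hN⟩ := h (closedCodes g) closedCodes_isFunction fun n x hx => by
    rw [mem_closedTerm_iff] at hx ⊢
    exact ⟨hx.1, fun m hm => hx.2 m (hm.trans le_self_add)⟩
  obtain ⟨x, hx, hx'⟩ := exists_nextStage_code (g := g) (N + 1)
  have hxN : x ∈ (stageValueOrder g).finFlat.upper.closedTerm (closedCodes g) N := by
    rw [mem_closedTerm_iff]
    refine ⟨⟨hx, fun p hp => ?_⟩, fun m hm => ?_⟩
    · obtain ⟨s, r, -, rfl⟩ := (hx' p).1 hp
      exact ⟨_, trivial, _, trivial, rfl⟩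
    · obtain ⟨s, r, hsr, h⟩ := exists_nextStage_bound (g := g) (lt_add_one_iff.2 hm)
      refine ⟨s, r, hsr, fun p hp => ?_⟩
      obtain ⟨s', r', hsr', rfl⟩ := (hx' p).1 hp
      rw [stageValueOrder_le_iff, stageValueOrder_le_iff]
      exact (h s' r' hsr').imp (fun h => ⟨h, Or.inl rfl⟩) fun h => ⟨stageLe_zero _, h⟩
  rw [← hN (N + 1) (lt_add_one N), mem_closedTerm_iff] at hxN
  obtain ⟨s, r, hsr, hp⟩ := hxN.2 (N + 1) le_rfl
  -- Membership in the next closed set would put `(2s, 2r + 1)`, an element of `x` itself, below one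
  -- of its own two bounds.
  rcases hp _ ((hx' _).2 ⟨s, r, hsr, rfl⟩) with h | h
  · exact not_stageLe_succ s (stageValueOrder_le_iff.1 h).1
  · exact not_valueLe_pred r (stageValueOrder_le_iff.1 h).2

end

/-! ### Enumerating a `Σ⁰₁` set -/

section

variable (P : M → M → Prop)

/-- `s` is a pair of a number and the least witness for it. -/
def IsFirstWitness (s n : M) : Prop :=
  ∃ y, y ≤ s ∧ (s = pair n y ∧ (P n y ∧ ∀ y', y' < y → ¬ P n y'))

/-- At stage `s + 1` the number `2 n + 1` is enumerated if `s` is a pair of `n` and the least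
witness for `n`, and `2 s + 2` is enumerated if `s` is not of this form. -/
def EnumeratedAt (r v : M) : Prop :=
  (r = 0 ∧ v = 0) ∨ ∃ s, s ≤ r ∧ (r = s + 1 ∧
    ((∃ n, n ≤ s ∧ (IsFirstWitness P s n ∧ v = n + n + 1)) ∨
      ((∀ n, n ≤ s → ¬ IsFirstWitness P s n) ∧ v = s + 1 + (s + 1))))

variable {P}

theorem IsFirstWitness.unique {s n n' : M} (h : IsFirstWitness P s n)
    (h' : IsFirstWitness P s n') : n = n' := by
  obtain ⟨y, -, rfl, -⟩ := h
  obtain ⟨y', -, h', -⟩ := h'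
  exact (pair_inj.1 h').1

theorem IsFirstWitness.unique_stage {s s' n : M} (h : IsFirstWitness P s n)
    (h' : IsFirstWitness P s' n) : s = s' := by
  obtain ⟨y, -, rfl, h₁, h₂⟩ := h
  obtain ⟨y', -, rfl, h₁', h₂'⟩ := h'
  rcases lt_trichotomy y y' with h | rfl | h
  · exact absurd h₁ (h₂' y h)
  · rfl
  · exact absurd h₁' (h₂ y' h)

theorem IsFirstWitness.le {s n : M} (h : IsFirstWitness P s n) : n ≤ s := by
  obtain ⟨y, -, rfl, -⟩ := h
  exact left_le_pair _ _

theorem enumeratedAt_zero {v : M} : EnumeratedAt P 0 v ↔ v = 0 := by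
  constructor
  · rintro (⟨-, h⟩ | ⟨s, -, h, -⟩)
    · exact h
    · exact absurd h (zero_le.trans_lt (lt_add_one s)).ne
  · exact fun h => Or.inl ⟨rfl, h⟩

theorem enumeratedAt_succ {s v : M} : EnumeratedAt P (s + 1) v ↔
    (∃ n, IsFirstWitness P s n ∧ v = n + n + 1) ∨
      ((∀ n, ¬ IsFirstWitness P s n) ∧ v = s + 1 + (s + 1)) := by
  constructor
  · rintro (⟨h, -⟩ | ⟨s', -, h, h'⟩)
    · exact absurd h (zero_le.trans_lt (lt_add_one s)).ne'
    · obtain rfl := add_right_cancel h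
      rcases h' with ⟨n, -, h⟩ | ⟨h, h'⟩
      · exact Or.inl ⟨n, h⟩
      · exact Or.inr ⟨fun n hn => h n hn.le hn, h'⟩
  · rintro (⟨n, h, h'⟩ | ⟨h, h'⟩)
    · exact Or.inr ⟨s, le_self_add, rfl, Or.inl ⟨n, h.le, h, h'⟩⟩
    · exact Or.inr ⟨s, le_self_add, rfl, Or.inr ⟨fun n _ => h n, h'⟩⟩

theorem existsUnique_enumeratedAt (r : M) : ∃! v, EnumeratedAt P r v := by
  rcases eq_zero_or_succ r with rfl | ⟨s, rfl⟩
  · simp only [enumeratedAt_zero, existsUnique_eq]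
  · simp only [enumeratedAt_succ]
    by_cases h : ∃ n, IsFirstWitness P s n
    · obtain ⟨n, hn⟩ := h
      refine ⟨n + n + 1, Or.inl ⟨n, hn, rfl⟩, ?_⟩
      rintro v (⟨n', hn', rfl⟩ | ⟨h, -⟩)
      · rw [hn.unique hn']
      · exact absurd hn (h n)
    · push Not at h
      refine ⟨_, Or.inr ⟨h, rfl⟩, ?_⟩
      rintro v (⟨n', hn', rfl⟩ | ⟨-, rfl⟩)
      · exact absurd hn' (h n')
      · rfl

/-- The values `0`, `2n + 1` and `2s + 2` are of three disjoint kinds. An odd value occurs once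
because the least witness of `n` fixes its stage, and `2s + 2` fixes `s`. -/
theorem EnumeratedAt.injective {r r' v : M} (h : EnumeratedAt P r v) (h' : EnumeratedAt P r' v) :
    r = r' := by
  have hodd : ∀ n : M, n + n + 1 ≠ 0 := fun n => (zero_le.trans_lt (lt_add_one (n + n))).ne'
  have heven : ∀ s : M, s + 1 + (s + 1) ≠ 0 := fun s =>
    ((zero_le.trans_lt (lt_add_one s)).trans_le le_self_add).ne'
  rcases eq_zero_or_succ r with rfl | ⟨s, rfl⟩ <;> rcases eq_zero_or_succ r' with rfl | ⟨s', rfl⟩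
  · rfl
  · rw [enumeratedAt_zero] at h
    rw [enumeratedAt_succ] at h'
    rcases h' with ⟨n, -, h'⟩ | ⟨-, h'⟩
    · exact absurd (h'.symm.trans h) (hodd n)
    · exact absurd (h'.symm.trans h) (heven s')
  · rw [enumeratedAt_zero] at h'
    rw [enumeratedAt_succ] at h
    rcases h with ⟨n, -, h⟩ | ⟨-, h⟩
    · exact absurd (h.symm.trans h') (hodd n)
    · exact absurd (h.symm.trans h') (heven s)
  · rw [enumeratedAt_succ] at h h'
    rcases h with ⟨n, hn, rfl⟩ | ⟨-, rfl⟩ <;> rcases h' with ⟨n', hn', h'⟩ | ⟨-, h'⟩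
    · obtain rfl := double_inj.1 (add_right_cancel h')
      rw [hn.unique_stage hn']
    · exact absurd h' (double_add_one_ne_double _ _)
    · exact absurd h'.symm (double_add_one_ne_double _ _)
    · exact double_inj.1 h'

theorem EnumeratedAt.le {r v : M} (h : EnumeratedAt P r v) : v ≤ r + r := by
  rcases eq_zero_or_succ r with rfl | ⟨s, rfl⟩
  · rw [enumeratedAt_zero] at h
    rw [h]
    exact zero_le
  · rw [enumeratedAt_succ] at h
    rcases h with ⟨n, hn, rfl⟩ | ⟨-, rfl⟩
    · exact (double_add_one_lt_double.2 (hn.le.trans_lt (lt_add_one s))).le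
    · exact le_rfl

theorem exists_enumeratedAt_iff [Sigma0 fun e => P (e 0) (e 1)] {n : M} :
    (∃ r, EnumeratedAt P r (n + n + 1)) ↔ ∃ y, P n y := by
  constructor
  · rintro ⟨r, h⟩
    rcases eq_zero_or_succ r with rfl | ⟨s, rfl⟩
    · rw [enumeratedAt_zero] at h
      exact absurd h (zero_le.trans_lt (lt_add_one (n + n))).ne'
    · rw [enumeratedAt_succ] at h
      rcases h with ⟨n', ⟨y, -, -, hy, -⟩, h⟩ | ⟨-, h⟩
      · obtain rfl := double_inj.1 (add_right_cancel h)
        exact ⟨y, hy⟩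
      · exact absurd h (double_add_one_ne_double _ _)
  · intro h
    have hP : Sigma0 fun e : ℕ → M => P n (e 0) :=
      Sigma0.comp₂ (P := P) inferInstance (fun _ => n) fun e => e 0
    obtain ⟨y, hy, hy'⟩ := exists_least' (fun y => P n y) h
    exact ⟨pair n y + 1, enumeratedAt_succ.2
        (Or.inl ⟨n, ⟨y, right_le_pair _ _, rfl, hy, hy'⟩, rfl⟩)⟩

theorem Sigma0.enumeratedAt (hP : Sigma0 fun e => P (e 0) (e 1)) {r v : (ℕ → M) → M} [TermDef r]
    [TermDef v] : Sigma0 fun e => EnumeratedAt P (r e) (v e) := by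
  have := hP.comp₂
  have h : ∀ (s n : (ℕ → M) → M) [TermDef s] [TermDef n],
      Sigma0 fun e => IsFirstWitness P (s e) (n e) := by
    refine Sigma0.comp₂ (P := IsFirstWitness P) ?_
    unfold IsFirstWitness
    infer_instance
  refine Sigma0.comp₂ (P := EnumeratedAt P) ?_ r v
  unfold EnumeratedAt
  infer_instance

/-- Every `Σ⁰₁` set is computable from the range of a definable injection. -/
theorem exists_pairedEnumeration (hP : Sigma0 fun e => P (e 0) (e 1)) :
    ∃ g : M → M, PairedEnumeration g ∧
      ∀ n, (∃ y, P n y) ↔ ∃ x, g x = n + n + 1 + (n + n + 1) := by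
  choose h hh hh' using existsUnique_enumeratedAt (P := P)
  have hiff : ∀ r v, EnumeratedAt P r v ↔ h r = v := fun r v =>
    ⟨fun hv => (hh' r v hv).symm, fun hv => hv ▸ hh r⟩
  -- Doubling gives `g (2r) = 2 h r` and `g (2r + 1) = 2 h r + 1`, so membership of `n`, recorded by
  -- `h` as `2n + 1`, appears in the range of `g` as `2(2n + 1)`.
  have hg : ∀ x, ∃ v, ∃ r, (x = r + r ∧ v = h r + h r) ∨ (x = r + r + 1 ∧ v = h r + h r + 1) := by
    intro x
    obtain ⟨r, hr | hr⟩ := even_or_odd x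
    exacts [⟨_, r, Or.inl ⟨hr, rfl⟩⟩, ⟨_, r, Or.inr ⟨hr, rfl⟩⟩]
  choose g hg using hg
  have hge : ∀ r, g (r + r) = h r + h r := by
    intro r
    obtain ⟨r', ⟨h₁, h₂⟩ | ⟨h₁, -⟩⟩ := hg (r + r)
    · rw [h₂, double_inj.1 h₁]
    · exact absurd h₁.symm (double_add_one_ne_double _ _)
  have hgo : ∀ r, g (r + r + 1) = h r + h r + 1 := by
    intro r
    obtain ⟨r', ⟨h₁, -⟩ | ⟨h₁, h₂⟩⟩ := hg (r + r + 1)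
    · exact absurd h₁ (double_add_one_ne_double _ _)
    · rw [h₂, double_inj.1 (add_right_cancel h₁)]
  have hinj : ∀ r r', h r = h r' → r = r' := fun r r' hr => (hr ▸ hh r).injective (hh r')
  -- This bound keeps the quantifiers over values bounded, so that `g (e 0) < g (e 1)` is a `Σ⁰₀`
  -- predicate.
  have hle : ∀ x, g x ≤ x + x := by
    intro x
    obtain ⟨r, ⟨rfl, h₂⟩ | ⟨rfl, h₂⟩⟩ := hg x
    · rw [h₂]
      exact add_le_add (hh r).le (hh r).le
    · rw [h₂]
      have h₁ : r + r + 1 + (r + r + 1) = r + r + (r + r) + 1 + 1 := by ring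
      rw [h₁]
      exact (add_le_add (add_le_add (hh r).le (hh r).le) le_rfl).trans le_self_add
  have hE : ∀ (r v : (ℕ → M) → M) [TermDef r] [TermDef v],
      Sigma0 fun e => EnumeratedAt P (r e) (v e) := fun r v => hP.enumeratedAt
  have hgraph : Sigma0 fun e : ℕ → M => g (e 0) = e 1 := by
    refine Sigma0.congr (P := fun e => ∃ r, r ≤ e 0 ∧ ∃ w, w ≤ e 1 ∧ (EnumeratedAt P r w ∧
      ((e 0 = r + r ∧ e 1 = w + w) ∨ (e 0 = r + r + 1 ∧ e 1 = w + w + 1)))) (by infer_instance)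
      fun e => ?_
    constructor
    · intro he
      rw [← he]
      obtain ⟨r, hr⟩ := hg (e 0)
      refine ⟨r, ?_, h r, ?_, hh r, hr⟩
      · rcases hr with ⟨h₁, -⟩ | ⟨h₁, -⟩
        · rw [h₁]
          exact le_self_add
        · rw [h₁]
          exact le_self_add.trans le_self_add
      · rcases hr with ⟨-, h₁⟩ | ⟨-, h₁⟩
        · rw [h₁]
          exact le_self_add
        · rw [h₁]
          exact le_self_add.trans le_self_add
    · rintro ⟨r, -, w, -, hw, ⟨h₁, h₂⟩ | ⟨h₁, h₂⟩⟩
      · rw [h₁, h₂, hge, (hiff r w).1 hw]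
      · rw [h₁, h₂, hgo, (hiff r w).1 hw]
  have hgraph' := hgraph.comp₂ (P := fun x v => g x = v)
  refine ⟨g, ⟨hgraph, ?_, ?_, ?_, fun r => by rw [hgo, hge]⟩, fun n => ?_⟩
  · refine Sigma0.congr (P := fun e => ∃ v, v ≤ e 0 + e 0 ∧ ∃ w, w ≤ e 1 + e 1 ∧
      (g (e 0) = v ∧ (g (e 1) = w ∧ v < w))) (by infer_instance) fun e => ?_
    constructor
    · exact fun he => ⟨_, hle _, _, hle _, rfl, rfl, he⟩
    · rintro ⟨_, -, _, -, rfl, rfl, he⟩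
      exact he
  · intro x x' hxx
    obtain ⟨r, ⟨rfl, h₁⟩ | ⟨rfl, h₁⟩⟩ := hg x <;> obtain ⟨r', ⟨rfl, h₂⟩ | ⟨rfl, h₂⟩⟩ := hg x' <;>
      rw [h₁, h₂] at hxx
    · rw [hinj r r' (double_inj.1 hxx)]
    · exact absurd hxx.symm (double_add_one_ne_double _ _)
    · exact absurd hxx (double_add_one_ne_double _ _)
    · rw [hinj r r' (double_inj.1 (add_right_cancel hxx))]
  · have h0 : h 0 = 0 := (hiff 0 0).1 (enumeratedAt_zero.2 rfl)
    have := hge 0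
    rwa [h0, add_zero] at this
  · rw [← exists_enumeratedAt_iff (P := P)]
    constructor
    · rintro ⟨r, hr⟩
      exact ⟨r + r, by rw [hge, (hiff _ _).1 hr]⟩
    · rintro ⟨x, hx⟩
      obtain ⟨r, ⟨rfl, h₁⟩ | ⟨rfl, h₁⟩⟩ := hg x <;> rw [h₁] at hx
      · exact ⟨r, (hiff _ _).2 (double_inj.1 hx)⟩
      · exact absurd hx (double_add_one_ne_double _ _)

end

theorem sigma1Comprehension_of_flatUpperNoetherian (hM : FlatUpperNoetherian M) :
    Sigma1Comprehension M := by
  intro P hP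
  obtain ⟨g, hg, hPg⟩ := exists_pairedEnumeration hP
  by_contra hc
  refine not_isNoetherian (g := g) (hM _ (stageValueOrder_isWqo fun hrange => hc ?_))
  obtain ⟨R, hR⟩ : ∃ R : Set M, R = {n | ∃ x, g x = n} := ⟨_, rfl⟩
  rw [← hR] at hrange
  have : InSets R := ⟨hrange⟩
  have : Sigma0 fun e : ℕ → M => e 0 + e 0 + 1 + (e 0 + e 0 + 1) ∈ R :=
    Sigma0.mem (t := fun e => e 0 + e 0 + 1 + (e 0 + e 0 + 1))
  have h := setOf_mem_sets fun n : M => n + n + 1 + (n + n + 1) ∈ R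
  subst hR
  simpa only [hPg, Set.mem_ofPred_eq] using h

end SecondOrderArithmetic

/-- Over `RCA₀`, the statement "if `Q` is a wqo, then the upper topology of `P_f^♭(Q)` is
Noetherian" implies `ACA₀`: every structure of second-order arithmetic, standard or not, that
satisfies `RCA₀` and the statement satisfies `ACA₀`. -/
theorem theorem4p4 (M : Type*) [SecondOrderArithmetic.L2Structure M]
    (hRCA : SecondOrderArithmetic.IsModelRCA0 M)
    (hNoeth : SecondOrderArithmetic.FlatUpperNoetherian M) :
    SecondOrderArithmetic.IsModelACA0 M := by
  have : SecondOrderArithmetic.ModelRCA0 M := ⟨hRCA⟩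
  exact SecondOrderArithmetic.isModelACA0_of_sigma1Comprehension
    (SecondOrderArithmetic.sigma1Comprehension_of_flatUpperNoetherian hNoeth)
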